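/- **Setting.** Let $\varphi:(0,\infty)\to(0,\infty)$ satisfy: (i) $\varphi\in C^1((0,\infty))$; (ii) $(s\varphi(s))'>0$ for all $s>0$; (iii) the range of $s\mapsto s\varphi(s)$ on $(0,\infty)$ is $(0,\infty)$; (iv) there are $C_1,C_2>0$, $r>-1$ and $s_0>0$ with $C_1s^r\le (s\varphi(s))'\le C_2s^r$ for $s\in(0,s_0)$ and, if $r=0$, moreover $\lim_{s\to0^+}\varphi(s)$ exists, is finite and positive, and $\lim_{s\to0^+}s\varphi'(s)=0$; (v) there is $s_1>s_0$ such that either $\varphi'\ge0$ on $[s_1,\infty)$ or $\varphi'\le0$ on $[s_1,\infty)$; (vi) $s\mapsto|s\varphi'(s)/\varphi(s)|$ is non-decreasing on $(0,\infty)$. Define $\Lambda$ on $(0,\infty)$ by $$\Lambda\big(s\sqrt{\varphi(s)}\big)=-\frac{s\varphi'(s)}{s\varphi'(s)+2\varphi(s)}\qquad(s>0),$$ and put $\Lambda_\infty^2=\sup_{t>0}\Lambda(t)^2$. Let $\Omega\subset\mathbb R^n$ be a domain and let $\langle\cdot,\cdot\rangle$ be the Hermitian inner product of $\mathbb C^m$.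 For $m\times m$ matrices $\mathscr A^{hk}$ ($1\le h,k\le n$) with entries in $L^1_{\rm loc}(\Omega;\mathbb C)$ consider $A=\partial_h(\mathscr A^{hk}\partial_k)$ (repeated indices are summed). Let $C_c^1(\Omega)^m$ be the space of $C^1$ functions $\Omega\to\mathbb C^m$ with compact support in $\Omega$. * $A$ is *$L^\Phi$-dissipative* if $\operatorname{Re}\int_\Omega\langle\mathscr A^{hk}\partial_ku,\partial_h(\varphi(|u|)u)\rangle\,dx\ge0$ for all $u\in C^1_c(\Omega)^m$ with $\varphi(|u|)u\in C_c^1(\Omega)^m$. * $A$ is *strictly $L^\Phi$-dissipative* if there is $\kappa>0$ such that for all such $u$ $$\operatorname{Re}\int_\Omega\langle\mathscr A^{hk}\partial_ku,\partial_h(\varphi(|u|)u)\rangle\,dx\ge\kappa\int_\Omega|\nabla(\sqrt{\varphi(|u|)}\,u)|^2dx .$$ * $A$ is *integrally $\Phi$-elliptic* if there is $\kappa>0$ such that for all $v\in C_c^1(\Omega)^m$ $$\operatorname{Re}\int_\Omega\Big(\langle\mathscr A^{hk}\partial_kv,\partial_hv\rangle+\Lambda(|v|)|v|^{-2}\langle(\mathscr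 A^{hk}-(\mathscr A^{kh})^*)v,\partial_hv\rangle\operatorname{Re}\langle v,\partial_kv\rangle-\Lambda^2(|v|)|v|^{-4}\langle\mathscr A^{hk}v,v\rangle\operatorname{Re}\langle v,\partial_kv\rangle\operatorname{Re}\langle v,\partial_hv\rangle\Big)dx\ge\kappa\int_\Omega|\nabla v|^2dx,$$ the integrand on the left being extended by zero to the set where $v=0$. * $A$ is *strongly $\Phi$-elliptic* if there is $\kappa>0$ such that for almost every $x\in\Omega$ $$\operatorname{Re}\langle\mathscr A^{hk}\xi_k,\xi_h\rangle+\Lambda(t)\operatorname{Re}\langle(\mathscr A^{hk}-(\mathscr A^{kh})^*)\omega,\xi_h\rangle\operatorname{Re}\langle\omega,\xi_k\rangle-\Lambda^2(t)\operatorname{Re}\langle\mathscr A^{hk}\omega,\omega\rangle\operatorname{Re}\langle\omega,\xi_k\rangle\operatorname{Re}\langle\omega,\xi_h\rangle\ge\kappa|\xi|^2$$ for all $\xi=(\xi_1,\dots,\xi_n)\in(\mathbb C^m)^n$, all $\omega\in\mathbb C^m$ with $|\omega|=1$ and all $t>0$ (matrices evaluated at $x$). * $A$ is *weakly (Legendre–Hadamard)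 $\Phi$-elliptic* if there is $\kappa>0$ such that for almost every $x\in\Omega$, with $M=\mathscr A^{hk}(x)q_hq_k$, $$\operatorname{Re}\langle M\lambda,\lambda\rangle-\Lambda^2(t)\operatorname{Re}\langle M\omega,\omega\rangle(\operatorname{Re}\langle\lambda,\omega\rangle)^2+\Lambda(t)\operatorname{Re}\big(\langle M\omega,\lambda\rangle-\langle M\lambda,\omega\rangle\big)\operatorname{Re}\langle\lambda,\omega\rangle\ge\kappa|q|^2|\lambda|^2$$ for all $q\in\mathbb R^n$, all $\lambda,\omega\in\mathbb C^m$ with $|\omega|=1$ and all $t>0$. **Theorem.** Let $n\ge2$, let $A=\partial_h(\mathscr A^h(x)\partial_h)$, where the $\mathscr A^h$ ($1\le h\le n$) are $m\times m$ matrices with complex entries that are locally integrable in the domain $\Omega\subset\mathbb R^n$ (that is, $\mathscr A^{hk}=\delta_{hk}\mathscr A^h$), and assume $\Lambda_\infty^2<1$. The following statements are equivalent: (a) $A$ is strictly $L^\Phi$-dissipative; (b) there is $\kappa>0$ such that $A-\kappa\Delta$ (with coefficients $\delta_{hk}(\mathscr A^h-\kappa I)$) is $L^\Phi$-dissipative;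 (c) $A$ is integrally $\Phi$-elliptic; (d) $A$ is weakly $\Phi$-elliptic. Moreover, if $A$ is strongly $\Phi$-elliptic, then (a)–(d) hold. -/

import Mathlib

open MeasureTheory Set Filter Topology

/-- `ℝⁿ` with its Euclidean norm. -/
abbrev RSpace (n : ℕ) : Type := EuclideanSpace ℝ (Fin n)

/-- `ℂᵐ` with its Hermitian norm. -/
abbrev CSpace (m : ℕ) : Type := EuclideanSpace ℂ (Fin m)

/-- The standing conditions on the positive function `φ` on `(0, ∞)`;
only the values of `φ` at positive arguments matter. -/
structure AdmissiblePhi (φ : ℝ → ℝ) : Prop where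
  pos : ∀ s, 0 < s → 0 < φ s
  contDiffOn : ContDiffOn ℝ 1 φ (Ioi 0)
  deriv_pos : ∀ s, 0 < s → 0 < deriv (fun σ => σ * φ σ) s
  range_eq : (fun s => s * φ s) '' Ioi 0 = Ioi 0
  /-- The growth condition near `0` and the monotonicity of `φ` near infinity. -/
  growth : ∃ C₁ C₂ r s₀ s₁ : ℝ, 0 < C₁ ∧ 0 < C₂ ∧ -1 < r ∧ 0 < s₀ ∧ s₀ < s₁ ∧
    (∀ s ∈ Ioo 0 s₀, C₁ * s ^ r ≤ deriv (fun σ => σ * φ σ) s ∧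
      deriv (fun σ => σ * φ σ) s ≤ C₂ * s ^ r) ∧
    (r = 0 → (∃ c : ℝ, 0 < c ∧ Tendsto φ (𝓝[>] 0) (𝓝 c)) ∧
      Tendsto (fun s => s * deriv φ s) (𝓝[>] 0) (𝓝 0)) ∧
    ((∀ s, s₁ ≤ s → 0 ≤ deriv φ s) ∨ (∀ s, s₁ ≤ s → deriv φ s ≤ 0))
  monotone_abs : MonotoneOn (fun s => |s * deriv φ s / φ s|) (Ioi 0)

/-- For `t > 0`, the `s > 0` with `s √φ(s) = t` (it exists and is unique, see
`AdmissiblePhi.injOn` and `AdmissiblePhi.surjOn`). -/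
noncomputable def lamParam (φ : ℝ → ℝ) (t : ℝ) : ℝ :=
  Function.invFunOn (fun s => s * √(φ s)) (Ioi 0) t

/-- The function `Λ` on `(0, ∞)`, determined by
`Λ (s √φ(s)) = - s φ'(s) / (s φ'(s) + 2 φ(s))` for `s > 0` (see `Lam_spec`). -/
noncomputable def Lam (φ : ℝ → ℝ) (t : ℝ) : ℝ :=
  -(lamParam φ t * deriv φ (lamParam φ t) /
    (lamParam φ t * deriv φ (lamParam φ t) + 2 * φ (lamParam φ t)))

/-- `Λ_∞² = sup_{t > 0} Λ(t)²` (a supremum of numbers in `[0, 1)`, see `Lam_sq_lt_one`). -/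
noncomputable def LamInfSq (φ : ℝ → ℝ) : ℝ :=
  sSup ((fun t => Lam φ t ^ 2) '' Ioi 0)

/-- `Re ⟨x, y⟩` for the Hermitian inner product of `ℂᵐ` (symmetric in `x` and `y`, so that it does
not matter which argument is the conjugate-linear one). -/
noncomputable def reInner {m : ℕ} (x y : CSpace m) : ℝ := (inner ℂ x y).re

/-- A matrix applied to a vector of `ℂᵐ`. -/
noncomputable def matAct {m : ℕ} (M : Matrix (Fin m) (Fin m) ℂ) (v : CSpace m) : CSpace m :=
  Matrix.toEuclideanLin M v

/-- Coefficients of an operator `∂_h (𝒜^{hk}(x) ∂_k)`: the matrix `𝒜^{hk}(x)` is `T h k x`. -/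
abbrev CoeffTensor (n m : ℕ) : Type := Fin n → Fin n → RSpace n → Matrix (Fin m) (Fin m) ℂ

/-- The coefficients `δ_{hk} 𝒜^h(x)` of the operator `∂_h (𝒜^h(x) ∂_h)`. -/
def diagTensor {n m : ℕ} (a : Fin n → RSpace n → Matrix (Fin m) (Fin m) ℂ) : CoeffTensor n m :=
  fun h k x => if h = k then a h x else 0

/-- The coefficients `𝒜^{hk}(x) - κ δ_{hk} I` of the operator `A - κ Δ`. -/
noncomputable def subLaplacian {n m : ℕ} (T : CoeffTensor n m) (κ : ℝ) : CoeffTensor n m :=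
  fun h k x => T h k x - if h = k then (κ : ℂ) • (1 : Matrix (Fin m) (Fin m) ℂ) else 0

/-- The partial derivative `∂_h u (x)`. -/
noncomputable def pd {n m : ℕ} (h : Fin n) (u : RSpace n → CSpace m) (x : RSpace n) : CSpace m :=
  fderiv ℝ u x (EuclideanSpace.single h 1)

/-- `|∇u(x)|²`. -/
noncomputable def gradSq {n m : ℕ} (u : RSpace n → CSpace m) (x : RSpace n) : ℝ :=
  ∑ h, ‖pd h u x‖ ^ 2

/-- Membership in `[C_c¹(Ω)]ᵐ`; functions on `Ω` with compact support in `Ω` are extended by zero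
to `ℝⁿ`. -/
def IsTest {n m : ℕ} (Ω : Set (RSpace n)) (u : RSpace n → CSpace m) : Prop :=
  ContDiff ℝ 1 u ∧ HasCompactSupport u ∧ tsupport u ⊆ Ω

/-- `φ(|u|) u`, which is `0` where `u` vanishes. -/
noncomputable def phiMul {n m : ℕ} (φ : ℝ → ℝ) (u : RSpace n → CSpace m) :
    RSpace n → CSpace m :=
  fun x => φ ‖u x‖ • u x

/-- `√φ(|u|) u`, which is `0` where `u` vanishes. -/
noncomputable def sqrtPhiMul {n m : ℕ} (φ : ℝ → ℝ) (u : RSpace n → CSpace m) :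
    RSpace n → CSpace m :=
  fun x => √(φ ‖u x‖) • u x

/-- `Re ∫_Ω ⟨𝒜^{hk} ∂_k u, ∂_h w⟩ dx`. -/
noncomputable def energy {n m : ℕ} (Ω : Set (RSpace n)) (T : CoeffTensor n m)
    (u w : RSpace n → CSpace m) : ℝ :=
  ∫ x in Ω, ∑ h, ∑ k, reInner (matAct (T h k x) (pd k u x)) (pd h w x)

/-- `L^Φ`-dissipativity of the operator `∂_h (𝒜^{hk} ∂_k)` in `Ω`. -/
def PhiDissipative {n m : ℕ} (φ : ℝ → ℝ) (Ω : Set (RSpace n)) (T : CoeffTensor n m) : Prop :=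
  ∀ u : RSpace n → CSpace m, IsTest Ω u → IsTest Ω (phiMul φ u) →
    0 ≤ energy Ω T u (phiMul φ u)

/-- Strict `L^Φ`-dissipativity of the operator `∂_h (𝒜^{hk} ∂_k)` in `Ω`. -/
def StrictPhiDissipative {n m : ℕ} (φ : ℝ → ℝ) (Ω : Set (RSpace n)) (T : CoeffTensor n m) :
    Prop :=
  ∃ κ : ℝ, 0 < κ ∧ ∀ u : RSpace n → CSpace m, IsTest Ω u → IsTest Ω (phiMul φ u) →
    κ * (∫ x in Ω, gradSq (sqrtPhiMul φ u) x) ≤ energy Ω T u (phiMul φ u)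

/-- The real part of the integrand
`⟨𝒜^{hk} ∂_k v, ∂_h v⟩ + Λ(|v|) |v|⁻² ⟨(𝒜^{hk} - (𝒜^{kh})*) v, ∂_h v⟩ Re ⟨v, ∂_k v⟩
 - Λ(|v|)² |v|⁻⁴ ⟨𝒜^{hk} v, v⟩ Re ⟨v, ∂_k v⟩ Re ⟨v, ∂_h v⟩`,
extended by zero to the set where `v` vanishes. -/
noncomputable def phiIntegrand {n m : ℕ} (φ : ℝ → ℝ) (T : CoeffTensor n m)
    (v : RSpace n → CSpace m) (x : RSpace n) : ℝ :=
  {y | v y ≠ 0}.indicator (fun x => ∑ h, ∑ k,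
    (reInner (matAct (T h k x) (pd k v x)) (pd h v x)
      + Lam φ ‖v x‖ * (‖v x‖ ^ 2)⁻¹ *
          reInner (matAct (T h k x - (T k h x).conjTranspose) (v x)) (pd h v x) *
          reInner (v x) (pd k v x)
      - Lam φ ‖v x‖ ^ 2 * (‖v x‖ ^ 4)⁻¹ * reInner (matAct (T h k x) (v x)) (v x) *
          reInner (v x) (pd k v x) * reInner (v x) (pd h v x))) x

/-- The integral `Φ`-ellipticity condition. -/
def IntegralPhiElliptic {n m : ℕ} (φ : ℝ → ℝ) (Ω : Set (RSpace n)) (T : CoeffTensor n m) :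
    Prop :=
  ∃ κ : ℝ, 0 < κ ∧ ∀ v : RSpace n → CSpace m, IsTest Ω v →
    κ * (∫ x in Ω, gradSq v x) ≤ ∫ x in Ω, phiIntegrand φ T v x

/-- The strong `Φ`-ellipticity condition. -/
def StrongPhiElliptic {n m : ℕ} (φ : ℝ → ℝ) (Ω : Set (RSpace n)) (T : CoeffTensor n m) : Prop :=
  ∃ κ : ℝ, 0 < κ ∧ ∀ᵐ x ∂(volume.restrict Ω),
    ∀ (ξ : Fin n → CSpace m) (ω : CSpace m) (t : ℝ), ‖ω‖ = 1 → 0 < t →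
      κ * (∑ h, ‖ξ h‖ ^ 2) ≤ ∑ h, ∑ k,
        (reInner (matAct (T h k x) (ξ k)) (ξ h)
          + Lam φ t * reInner (matAct (T h k x - (T k h x).conjTranspose) ω) (ξ h) *
              reInner ω (ξ k)
          - Lam φ t ^ 2 * reInner (matAct (T h k x) ω) ω * reInner ω (ξ k) * reInner ω (ξ h))

/-- The symbol `𝒜^{hk}(x) q_h q_k`. -/
noncomputable def symbolMatrix {n m : ℕ} (T : CoeffTensor n m) (x q : RSpace n) :
    Matrix (Fin m) (Fin m) ℂ :=
  ∑ h, ∑ k, ((q h * q k : ℝ) : ℂ) • T h k x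

/-- The weak (Legendre–Hadamard) `Φ`-ellipticity condition. -/
def WeakPhiElliptic {n m : ℕ} (φ : ℝ → ℝ) (Ω : Set (RSpace n)) (T : CoeffTensor n m) : Prop :=
  ∃ κ : ℝ, 0 < κ ∧ ∀ᵐ x ∂(volume.restrict Ω),
    ∀ (q : RSpace n) (ξ ω : CSpace m) (t : ℝ), ‖ω‖ = 1 → 0 < t →
      κ * ‖q‖ ^ 2 * ‖ξ‖ ^ 2 ≤
        reInner (matAct (symbolMatrix T x q) ξ) ξ
          - Lam φ t ^ 2 * reInner (matAct (symbolMatrix T x q) ω) ω * reInner ξ ω ^ 2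
          + Lam φ t * (reInner (matAct (symbolMatrix T x q) ω) ξ
              - reInner (matAct (symbolMatrix T x q) ξ) ω) * reInner ξ ω

/-- The substitution `s ↦ s √φ(s)` is one-to-one on `(0, ∞)`. -/
theorem AdmissiblePhi.injOn {φ : ℝ → ℝ} (hφ : AdmissiblePhi φ) :
    InjOn (fun s => s * √(φ s)) (Ioi 0) := by
  have hmono : StrictMonoOn (fun s => s * φ s) (Ioi 0) := by
    apply strictMonoOn_of_deriv_pos (convex_Ioi 0)
    · exact continuousOn_id.mul hφ.contDiffOn.continuousOn
    · intro s hs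
      rw [interior_Ioi] at hs
      exact hφ.deriv_pos s hs
  have hs : StrictMonoOn (fun s => s * √(φ s)) (Ioi 0) := by
    intro a ha b hb hab
    have ha' : 0 < a := ha
    have hb' : 0 < b := hb
    have h1 : a * φ a < b * φ b := hmono ha hb hab
    have h0 : 0 < a * φ a := mul_pos ha' (hφ.pos a ha')
    have h2 : a * (a * φ a) < b * (b * φ b) := mul_lt_mul'' hab h1 ha'.le h0.le
    have e : ∀ c, 0 < c → (c * √(φ c)) ^ 2 = c * (c * φ c) := fun c hc => by
      rw [mul_pow, Real.sq_sqrt (hφ.pos c hc).le]; ring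
    refine lt_of_pow_lt_pow_left₀ 2 (by positivity) ?_
    simpa only [e a ha', e b hb'] using h2
  exact hs.injOn

/-- The substitution `s ↦ s √φ(s)` maps `(0, ∞)` onto `(0, ∞)`. -/
theorem AdmissiblePhi.surjOn {φ : ℝ → ℝ} (hφ : AdmissiblePhi φ) :
    SurjOn (fun s => s * √(φ s)) (Ioi 0) (Ioi 0) := by
  have hcφ := hφ.contDiffOn.continuousOn
  have hmono : StrictMonoOn (fun s => s * φ s) (Ioi 0) := by
    apply strictMonoOn_of_deriv_pos (convex_Ioi 0)
    · exact continuousOn_id.mul hcφ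
    · intro s hs
      rw [interior_Ioi] at hs
      exact hφ.deriv_pos s hs
  have hc : ContinuousOn (fun s => s * √(φ s)) (Ioi 0) := continuousOn_id.mul hcφ.sqrt
  intro t ht
  have ht' : (0 : ℝ) < t := ht
  have e : ∀ c, 0 < c → (c * √(φ c)) ^ 2 = c * (c * φ c) := fun c hc => by
    rw [mul_pow, Real.sq_sqrt (hφ.pos c hc).le]; ring
  have h1 : ∃ a ∈ Ioi (0 : ℝ), a * √(φ a) ≤ t := by
    obtain ⟨p, hp, hpt⟩ : t ∈ (fun s => s * φ s) '' Ioi 0 := by rw [hφ.range_eq]; exact ht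
    have hp' : (0 : ℝ) < p := hp
    refine ⟨min p t, lt_min hp' ht', ?_⟩
    have hm : 0 < min p t := lt_min hp' ht'
    refine (sq_le_sq₀ (by positivity) ht'.le).1 ?_
    rw [e _ hm, sq]
    exact mul_le_mul (min_le_right _ _)
      ((hmono.monotoneOn hm hp (min_le_left _ _)).trans_eq hpt)
      (mul_pos hm (hφ.pos _ hm)).le ht'.le
  have h2 : ∃ b ∈ Ioi (0 : ℝ), t ≤ b * √(φ b) := by
    obtain ⟨p, hp, hpt⟩ : t ∈ (fun s => s * φ s) '' Ioi 0 := by rw [hφ.range_eq]; exact ht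
    have hp' : (0 : ℝ) < p := hp
    have hm : 0 < max p t := lt_max_of_lt_left hp'
    refine ⟨max p t, hm, ?_⟩
    refine (sq_le_sq₀ ht'.le (by positivity)).1 ?_
    rw [e _ hm, sq]
    exact mul_le_mul (le_max_right _ _)
      (hpt.symm.trans_le (hmono.monotoneOn hp hm (le_max_left _ _))) ht'.le hm.le
  obtain ⟨a, ha, hat⟩ := h1
  obtain ⟨b, hb, hbt⟩ := h2
  exact isPreconnected_Ioi.intermediate_value ha hb hc ⟨hat, hbt⟩

/-- The relation that determines `Λ`. -/
theorem Lam_spec {φ : ℝ → ℝ} (hφ : AdmissiblePhi φ) {s : ℝ} (hs : 0 < s) :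
    Lam φ (s * √(φ s)) = -(s * deriv φ s / (s * deriv φ s + 2 * φ s)) := by
  have h : lamParam φ (s * √(φ s)) = s :=
    hφ.injOn.leftInvOn_invFunOn (show s ∈ Ioi (0 : ℝ) from hs)
  rw [Lam, h]

/-- All values of `Λ` on `(0, ∞)` lie in `(-1, 1)`. -/
theorem Lam_sq_lt_one {φ : ℝ → ℝ} (hφ : AdmissiblePhi φ) {t : ℝ} (ht : 0 < t) :
    Lam φ t ^ 2 < 1 := by
  obtain ⟨s, hs, rfl⟩ := hφ.surjOn (show t ∈ Ioi (0 : ℝ) from ht)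
  have hs' : 0 < s := hs
  have hp := hφ.pos s hs'
  have hd := hφ.deriv_pos s hs'
  have hdiff : DifferentiableAt ℝ φ s :=
    (hφ.contDiffOn.differentiableOn (by norm_num)).differentiableAt (Ioi_mem_nhds hs')
  have hder : deriv (fun σ => σ * φ σ) s = φ s + s * deriv φ s := by
    have := ((hasDerivAt_id' s).fun_mul hdiff.hasDerivAt).deriv
    simpa using this
  rw [hder] at hd
  change Lam φ (s * √(φ s)) ^ 2 < 1
  rw [Lam_spec hφ hs', neg_sq, div_pow, div_lt_one (by nlinarith)]
  nlinarith

/-! Only the real inner product `Re ⟨·, ·⟩` matters, and the substitution `v = √φ(|u|) u` turns the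
energy of `A` into `∫ ∑ B_h(v, ∂_h v)`, where `B_h` is the quadratic form
`⟨𝒜^h (ξ + Λ ⟨ω, ξ⟩ ω), ξ - Λ ⟨ω, ξ⟩ ω⟩` with `ω = v / |v|` and `Λ = Λ(|v|)`. Since the symbol
of `A` is `∑ q_h² 𝒜^h`, weak ellipticity says exactly that each `B_h` is uniformly positive, and
this pointwise bound integrates to (a), (b) and (c).

Conversely, each of (a), (b), (c) makes the energy of `A - κ Δ` nonnegative on sufficiently regular
functions. Let `u` be such a function that is equal to a constant `U₀` near the support of `ψ`, and
add to it `r⁻¹ ψ sin(r² x_h + α) ζ` with `α = 0` or `π / 2`. As `r → ∞` the derivatives in the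
directions other than `x_h` become negligible, and the energies for the two phases, divided by `r²`,
add up to `∫ ψ² ⟨(𝒜^h - κ I) ζ, D(φ(|U|) U)(U₀) ζ⟩ ≥ 0`. Since `ψ`, `U₀` and `ζ` are arbitrary,
the form `B_h` of `𝒜^h - κ I` is nonnegative; as `Λ_∞² < 1`, the form of `𝒜^h` exceeds it by at
least `κ (1 - Λ_∞²) |ξ|²`. -/

section Calculus

variable {E F : Type*} [NormedAddCommGroup E] [NormedSpace ℝ E] [NormedAddCommGroup F]
  [NormedSpace ℝ F]

theorem countable_simple_zeros (g : ℝ → F) :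
    {t | g t = 0 ∧ DifferentiableAt ℝ g t ∧ deriv g t ≠ 0}.Countable := by
  set S := {t | g t = 0 ∧ DifferentiableAt ℝ g t ∧ deriv g t ≠ 0}
  have : DiscreteTopology S := by
    rw [discreteTopology_subtype_iff]
    rintro t ⟨-, hd, hne⟩
    rw [← disjoint_iff, disjoint_principal_right]
    filter_upwards [hd.hasDerivAt.eventually_ne (c := (0 : F)) hne] with z hz hzS
    exact hz hzS.1
  exact TopologicalSpace.separableSpace_iff_countable.1 inferInstance

variable [FiniteDimensional ℝ E] [MeasurableSpace E] [BorelSpace E]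

theorem ae_fderiv_apply_eq_zero_of_eq_zero (μ : Measure E) [μ.IsAddHaarMeasure] {u : E → F}
    (hu : ContDiff ℝ 1 u) (w : E) : ∀ᵐ x ∂μ, u x = 0 → fderiv ℝ u x w = 0 := by
  have hmeas : MeasurableSet {x | u x = 0 → fderiv ℝ u x w = 0} := by
    have hzero : IsClosed {x | u x = 0} := isClosed_eq hu.continuous continuous_const
    have hderiv : IsClosed {x | fderiv ℝ u x w = 0} :=
      isClosed_eq ((hu.continuous_fderiv one_ne_zero).clm_apply continuous_const)
        continuous_const
    simpa only [imp_iff_not_or, compl_ofPred, ofPred_or] using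
      hzero.measurableSet.compl.union hderiv.measurableSet
  -- By Fubini it suffices to look at the lines parallel to `w`.
  refine ae_mem_of_ae_add_linearMap_mem
    (ContinuousLinearMap.toSpanSingleton ℝ w).toLinearMap volume μ hmeas fun y => ?_
  filter_upwards [(countable_simple_zeros fun t : ℝ => u (y + t • w)).ae_notMem volume]
    with t ht h0
  have hline : HasDerivAt (fun t : ℝ => y + t • w) w t := by
    simpa using ((hasDerivAt_id t).smul_const w).const_add y
  have hd : HasDerivAt (fun t : ℝ => u (y + t • w)) (fderiv ℝ u (y + t • w) w) t :=
    (hu.differentiable one_ne_zero _).hasFDerivAt.comp_hasDerivAt t hline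
  by_contra hne
  exact ht ⟨h0, hd.differentiableAt, by rwa [hd.deriv]⟩

theorem ae_fderiv_eq_zero_of_eq_zero (μ : Measure E) [μ.IsAddHaarMeasure] {u : E → F}
    (hu : ContDiff ℝ 1 u) : ∀ᵐ x ∂μ, u x = 0 → fderiv ℝ u x = 0 := by
  let b := Module.finBasis ℝ E
  filter_upwards [ae_all_iff.2 fun i => ae_fderiv_apply_eq_zero_of_eq_zero μ hu (b i)] with x hx h0
  exact ContinuousLinearMap.coe_injective (b.ext fun i => by simpa using hx i h0)

end Calculus

theorem contDiff_comp_mul_sq {K K' : ℝ → ℝ} {c : ℝ} (hc : 0 < c) (hK0 : K 0 = 0)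
    (hK : ∀ y, 0 < y → HasDerivAt K (K' y) y) (hK' : ContinuousOn K' (Ioi 0))
    (hb : ∀ y, 0 < y → |K y| ≤ y) (hb' : ∀ y, 0 < y → |K' y| ≤ 1) :
    ContDiff ℝ 1 fun τ => K (c * τ ^ 2) := by
  have hpos : ∀ τ : ℝ, τ ≠ 0 → 0 < c * τ ^ 2 := fun τ hτ => by positivity
  set f : ℝ → ℝ := fun τ => K (c * τ ^ 2)
  set f' : ℝ → ℝ := fun τ => K' (c * τ ^ 2) * (c * (2 * τ))
  have hf : ∀ τ ≠ 0, HasDerivAt f (f' τ) τ := fun τ hτ =>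
    (hK _ (hpos τ hτ)).comp τ (by simpa using (hasDerivAt_pow 2 τ).const_mul c)
  have hf_zero : ContinuousAt f 0 := by
    have hlim : Tendsto (fun τ : ℝ => c * τ ^ 2) (𝓝 0) (𝓝 0) := by
      simpa using (by fun_prop : Continuous fun τ : ℝ => c * τ ^ 2).tendsto 0
    rw [ContinuousAt, show f 0 = 0 by simp [f, hK0]]
    refine squeeze_zero_norm (fun τ => ?_) hlim
    rcases eq_or_ne τ 0 with rfl | hτ
    · simp [f, hK0]
    · exact hb _ (hpos τ hτ)
  have hf'_zero : ContinuousAt f' 0 := by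
    have hlim : Tendsto (fun τ : ℝ => |c * (2 * τ)|) (𝓝 0) (𝓝 0) := by
      simpa using (by fun_prop : Continuous fun τ : ℝ => |c * (2 * τ)|).tendsto 0
    rw [ContinuousAt, show f' 0 = 0 by simp [f']]
    refine squeeze_zero_norm (fun τ => ?_) hlim
    rcases eq_or_ne τ 0 with rfl | hτ
    · simp [f']
    · rw [Real.norm_eq_abs, abs_mul]
      exact mul_le_of_le_one_left (abs_nonneg _) (hb' _ (hpos τ hτ))
  have hderiv : ∀ τ, HasDerivAt f (f' τ) τ := hasDerivAt_of_hasDerivAt_of_ne' hf hf_zero hf'_zero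
  rw [contDiff_one_iff_deriv, funext fun τ => (hderiv τ).deriv, continuous_iff_continuousAt]
  refine ⟨fun τ => (hderiv τ).differentiableAt, fun τ => ?_⟩
  rcases eq_or_ne τ 0 with rfl | hτ
  · exact hf'_zero
  · have : ContinuousAt K' (c * τ ^ 2) := hK'.continuousAt (Ioi_mem_nhds (hpos τ hτ))
    exact (ContinuousAt.comp (f := fun τ : ℝ => c * τ ^ 2) this (by fun_prop)).mul (by fun_prop)

section LocallyIntegrable

variable {X F : Type*} [TopologicalSpace X] [T2Space X] [MeasurableSpace X] [BorelSpace X]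
  {μ : Measure X} {Ω K : Set X}

theorem integrable_indicator_norm_of_locallyIntegrableOn [NormedAddCommGroup F] {f : X → F}
    (hf : LocallyIntegrableOn f Ω μ) (hK : IsCompact K) (hKΩ : K ⊆ Ω) :
    Integrable (K.indicator fun x => ‖f x‖) (μ.restrict Ω) :=
  ((integrable_indicator_iff hK.measurableSet).2
    (hf.integrableOn_compact_subset hKΩ hK).norm).mono_measure Measure.restrict_le_self

theorem integrableOn_of_norm_le_mul_norm {F' : Type*} [NormedAddCommGroup F]
    [NormedAddCommGroup F'] {f : X → F} (hf : LocallyIntegrableOn f Ω μ) (hK : IsCompact K)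
    (hKΩ : K ⊆ Ω) {g : X → F'} {C : ℝ} (hg : AEStronglyMeasurable g (μ.restrict Ω))
    (hgC : ∀ x, ‖g x‖ ≤ ‖f x‖ * C) (hgK : ∀ x ∉ K, g x = 0) : IntegrableOn g Ω μ := by
  refine ((integrable_indicator_norm_of_locallyIntegrableOn hf hK hKΩ).mul_const C).mono' hg
    (Eventually.of_forall fun x => ?_)
  by_cases hx : x ∈ K
  · rw [indicator_of_mem hx]
    exact hgC x
  · simp [hgK x hx, hx]

variable [SecondCountableTopology X] [NormedAddCommGroup F] [InnerProductSpace ℝ F]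

theorem integrable_inner_clm_apply {A : X → F →L[ℝ] F} (hA : LocallyIntegrableOn A Ω μ)
    (hK : IsCompact K) (hKΩ : K ⊆ Ω) {u v : X → F} (hu : AEStronglyMeasurable u (μ.restrict Ω))
    (hv : AEStronglyMeasurable v (μ.restrict Ω)) {C D : ℝ} (huC : ∀ x, ‖u x‖ ≤ C)
    (hvD : ∀ x, ‖v x‖ ≤ D) (huK : ∀ x ∉ K, u x = 0) :
    IntegrableOn (fun x => inner ℝ (A x (u x)) (v x)) Ω μ := by
  refine integrableOn_of_norm_le_mul_norm (C := C * D) hA hK hKΩ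
    (((ContinuousLinearMap.id ℝ (F →L[ℝ] F)).aestronglyMeasurable_comp₂
      hA.aestronglyMeasurable hu).inner hv) (fun x => ?_) fun x hx => by simp [huK x hx]
  have hC : 0 ≤ C := (norm_nonneg _).trans (huC x)
  calc ‖inner ℝ (A x (u x)) (v x)‖ ≤ ‖A x (u x)‖ * ‖v x‖ := norm_inner_le_norm _ _
    _ ≤ ‖A x‖ * ‖u x‖ * ‖v x‖ := by gcongr; exact (A x).le_opNorm _
    _ ≤ ‖A x‖ * C * D := by gcongr; exacts [huC x, hvD x]
    _ = ‖A x‖ * (C * D) := mul_assoc _ _ _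

theorem integrable_inner_of_hasCompactSupport {f w : X → F} (hf : LocallyIntegrableOn f Ω μ)
    (hw : Continuous w) (hwc : HasCompactSupport w) (hwΩ : tsupport w ⊆ Ω) :
    IntegrableOn (fun x => inner ℝ (f x) (w x)) Ω μ := by
  obtain ⟨C, hC⟩ := hw.bounded_above_of_compact_support hwc
  refine integrableOn_of_norm_le_mul_norm (C := C) hf hwc hwΩ
    (hf.aestronglyMeasurable.inner hw.aestronglyMeasurable) (fun x => ?_)
    fun x hx => by simp [image_eq_zero_of_notMem_tsupport hx]
  exact (norm_inner_le_norm _ _).trans (by gcongr; exact hC x)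

theorem tendsto_integral_inner_of_locallyIntegrableOn {ι : Type*} {l : Filter ι}
    [l.IsCountablyGenerated] {f : X → F} (hf : LocallyIntegrableOn f Ω μ) (hK : IsCompact K)
    (hKΩ : K ⊆ Ω) {w : ι → X → F} {w₀ : X → F} {C : ℝ}
    (hw : ∀ᶠ i in l, AEStronglyMeasurable (w i) (μ.restrict Ω))
    (hwC : ∀ᶠ i in l, ∀ x, ‖w i x‖ ≤ C) (hwK : ∀ᶠ i in l, ∀ x ∉ K, w i x = 0)
    (hlim : ∀ x, Tendsto (fun i => w i x) l (𝓝 (w₀ x))) :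
    Tendsto (fun i => ∫ x in Ω, inner ℝ (f x) (w i x) ∂μ) l
      (𝓝 (∫ x in Ω, inner ℝ (f x) (w₀ x) ∂μ)) := by
  refine tendsto_integral_filter_of_dominated_convergence
    (fun x => K.indicator (fun x => ‖f x‖) x * C) ?_ ?_
    ((integrable_indicator_norm_of_locallyIntegrableOn hf hK hKΩ).mul_const C)
    (Eventually.of_forall fun x => tendsto_const_nhds.inner (hlim x))
  · filter_upwards [hw] with i hi
    exact hf.aestronglyMeasurable.inner hi
  · filter_upwards [hwC, hwK] with i hC hi
    refine Eventually.of_forall fun x => ?_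
    by_cases hx : x ∈ K
    · rw [indicator_of_mem hx]
      exact (norm_inner_le_norm _ _).trans (by gcongr; exact hC x)
    · simp [hi x hx, hx]

theorem ae_nonneg_of_setIntegral_isCompact_nonneg [μ.InnerRegular] (hΩ : MeasurableSet Ω)
    {f : X → ℝ} (hf : LocallyIntegrableOn f Ω μ) (h : ∀ K ⊆ Ω, IsCompact K → 0 ≤ ∫ x in K, f x ∂μ) :
    ∀ᵐ x ∂(μ.restrict Ω), 0 ≤ f x := by
  obtain ⟨g, hg, hfg⟩ := hf.aestronglyMeasurable
  have hneg : MeasurableSet {x | g x < 0} := hg.measurable measurableSet_Iio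
  suffices μ ({x | g x < 0} ∩ Ω) = 0 by
    rw [← Measure.restrict_apply hneg] at this
    filter_upwards [hfg, measure_eq_zero_iff_ae_notMem.1 this] with x hx hgx
    simpa [hx] using hgx
  by_contra hne
  obtain ⟨K, hKneg, hK, hKpos⟩ :=
    (hneg.inter hΩ).exists_lt_isCompact (pos_iff_ne_zero.2 hne)
  have hKΩ : K ⊆ Ω := fun x hx => (hKneg hx).2
  have hgK : ∀ x ∈ K, g x < 0 := fun x hx => (hKneg hx).1
  have hfgK : f =ᵐ[μ.restrict K] g := ae_restrict_of_ae_restrict_of_subset hKΩ hfg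
  have hint : IntegrableOn g K μ := (hf.integrableOn_compact_subset hKΩ hK).congr hfgK
  have hpos : 0 < ∫ x in K, -g x ∂μ := by
    rw [setIntegral_pos_iff_support_of_nonneg_ae (f := fun x => -g x) ?_ hint.neg]
    · exact hKpos.trans_le (measure_mono fun x hx => ⟨by simpa using (hgK x hx).ne, hx⟩)
    · filter_upwards [ae_restrict_mem hK.measurableSet] with x hx
      simpa using (hgK x hx).le
  have hnonneg := h K hKΩ hK
  rw [integral_congr_ae hfgK] at hnonneg
  rw [integral_neg] at hpos
  linarith

end LocallyIntegrable

theorem ae_nonneg_of_integral_sq_mul_nonneg {E : Type*} [NormedAddCommGroup E] [NormedSpace ℝ E]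
    [FiniteDimensional ℝ E] [MeasurableSpace E] [BorelSpace E] {μ : Measure E}
    [μ.InnerRegular] {Ω : Set E} (hΩ : IsOpen Ω) {f : E → ℝ} (hf : LocallyIntegrableOn f Ω μ)
    (h : ∀ ψ : E → ℝ, ContDiff ℝ 1 ψ → HasCompactSupport ψ → tsupport ψ ⊆ Ω →
      0 ≤ ∫ x in Ω, ψ x ^ 2 * f x ∂μ) :
    ∀ᵐ x ∂(μ.restrict Ω), 0 ≤ f x := by
  refine ae_nonneg_of_setIntegral_isCompact_nonneg hΩ.measurableSet hf fun K hKΩ hK => ?_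
  obtain ⟨L, hL, hKL, hLΩ⟩ := exists_compact_between hK hΩ hKΩ
  obtain ⟨g, hg, hg01, hgsupp, hgK⟩ := exists_contMDiff_support_eq_eq_one_iff (n := 1)
    (modelWithCornersSelf ℝ E) (isOpen_interior (s := L)) hK.isClosed hKL
  have hg0 : ∀ x, 0 ≤ g x := fun x => (hg01 ⟨x, rfl⟩).1
  have hg1 : ∀ x, g x ≤ 1 := fun x => (hg01 ⟨x, rfl⟩).2
  have hgL : ∀ x ∉ L, g x = 0 := fun x hx => by
    rw [← Function.notMem_support, hgsupp]
    exact fun hx' => hx (interior_subset hx')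
  -- The powers of `g` are test functions that decrease to the indicator function of `K`.
  have hnonneg : ∀ j : ℕ, 0 ≤ ∫ x in Ω, inner ℝ (f x) ((g x ^ (j + 1)) ^ 2) ∂μ := fun j => by
    have hts : tsupport (fun x => g x ^ (j + 1)) ⊆ L :=
      closure_minimal (fun x hx => by_contra fun hx' => hx (by simp [hgL x hx'])) hL.isClosed
    simpa using h (fun x => g x ^ (j + 1)) (hg.contDiff.pow _)
      (hL.of_isClosed_subset (isClosed_tsupport _) hts) (hts.trans hLΩ)
  have hlim : ∀ x, Tendsto (fun j : ℕ => (g x ^ (j + 1)) ^ 2) atTop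
      (𝓝 (K.indicator (fun _ => 1) x)) := fun x => by
    by_cases hx : x ∈ K
    · simp [(hgK x).1 hx, hx]
    · have hlt : g x < 1 := lt_of_le_of_ne (hg1 x) fun h1 => hx ((hgK x).2 h1)
      simpa [hx] using (((tendsto_pow_atTop_nhds_zero_of_lt_one (hg0 x) hlt).comp
        (tendsto_add_atTop_nat 1)).pow 2)
  have key := ge_of_tendsto' (tendsto_integral_inner_of_locallyIntegrableOn hf hL hLΩ (C := 1)
    (Eventually.of_forall fun j => ((hg.contDiff.continuous.pow _).pow 2).aestronglyMeasurable)
    (Eventually.of_forall fun j x => by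
      change ‖(g x ^ (j + 1)) ^ 2‖ ≤ 1
      rw [Real.norm_of_nonneg (sq_nonneg _)]
      exact pow_le_one₀ (pow_nonneg (hg0 x) _) (pow_le_one₀ (hg0 x) (hg1 x)))
    (Eventually.of_forall fun j x hx => by simp [hgL x hx]) hlim) hnonneg
  have hind : (fun x => inner ℝ (f x) (K.indicator (fun _ => (1 : ℝ)) x)) = K.indicator f := by
    ext x
    by_cases hx : x ∈ K <;> simp [hx]
  rwa [hind, setIntegral_indicator hK.measurableSet, inter_eq_right.2 hKΩ] at key

theorem ae_forall_mem_nonneg {X Y : Type*} [MeasurableSpace X] {μ : Measure X}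
    [TopologicalSpace Y] [SecondCountableTopology Y] {O : Set Y} {f : X → Y → ℝ}
    (hf : ∀ x, ContinuousOn (f x) O) (h : ∀ y ∈ O, ∀ᵐ x ∂μ, 0 ≤ f x y) :
    ∀ᵐ x ∂μ, ∀ y ∈ O, 0 ≤ f x y := by
  obtain ⟨D, hDc, hD⟩ := TopologicalSpace.exists_countable_dense O
  filter_upwards [(ae_ball_iff hDc).2 fun y _ => h y y.2] with x hx y hy
  have hclosed : IsClosed {y : O | 0 ≤ f x y} :=
    isClosed_le continuous_const (hf x).domRestrict
  exact hclosed.closure_subset_iff.2 hx (hD ⟨y, hy⟩)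

/-- Conditions (i)–(iii) on a positive function `G` on `(0, ∞)`: they say that `U ↦ G(|U|) U` is a
radial homeomorphism, of class `C¹` off the origin. They pass from `φ` to `√φ` and to sums. -/
structure IsRadialWeight (G : ℝ → ℝ) : Prop where
  pos : ∀ s, 0 < s → 0 < G s
  contDiffOn : ContDiffOn ℝ 1 G (Ioi 0)
  deriv_mul_pos : ∀ s, 0 < s → 0 < deriv (fun σ => σ * G σ) s
  image_mul : (fun s => s * G s) '' Ioi 0 = Ioi 0

theorem AdmissiblePhi.isRadialWeight {φ : ℝ → ℝ} (hφ : AdmissiblePhi φ) : IsRadialWeight φ :=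
  ⟨hφ.pos, hφ.contDiffOn, hφ.deriv_pos, hφ.range_eq⟩

/-- The inverse of `s ↦ s G(s)` on `(0, ∞)`, so that `lamParam φ` is `radialInv √φ`. Only its values
at positive arguments matter. -/
noncomputable def radialInv (G : ℝ → ℝ) : ℝ → ℝ :=
  Function.invFunOn (fun s => s * G s) (Ioi 0)

/-- The function `ρ ≥ 0` with `ρ(τ) G(ρ(τ)) = c τ²`. Since `c τ²` vanishes to second order at `0`,
it is `C¹` across the origin, and so are its products with smaller weights. -/
noncomputable def radialProfile (G : ℝ → ℝ) (c τ : ℝ) : ℝ :=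
  (Ioi 0).indicator (radialInv G) (c * τ ^ 2)

namespace IsRadialWeight

variable {G H : ℝ → ℝ} {s t : ℝ}

theorem differentiableAt (hG : IsRadialWeight G) (hs : 0 < s) : DifferentiableAt ℝ G s :=
  (hG.contDiffOn.differentiableOn one_ne_zero).differentiableAt (Ioi_mem_nhds hs)

theorem continuousOn_deriv (hG : IsRadialWeight G) : ContinuousOn (deriv G) (Ioi 0) :=
  hG.contDiffOn.continuousOn_deriv_of_isOpen isOpen_Ioi le_rfl

theorem hasDerivAt_mul (hG : IsRadialWeight G) (hs : 0 < s) :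
    HasDerivAt (fun σ => σ * G σ) (G s + s * deriv G s) s := by
  simpa using (hasDerivAt_id' s).fun_mul (hG.differentiableAt hs).hasDerivAt

theorem add_mul_deriv_pos (hG : IsRadialWeight G) (hs : 0 < s) : 0 < G s + s * deriv G s :=
  (hG.hasDerivAt_mul hs).deriv ▸ hG.deriv_mul_pos s hs

theorem mul_pos (hG : IsRadialWeight G) (hs : 0 < s) : 0 < s * G s :=
  _root_.mul_pos hs (hG.pos s hs)

theorem strictMonoOn_mul (hG : IsRadialWeight G) : StrictMonoOn (fun s => s * G s) (Ioi 0) :=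
  strictMonoOn_of_deriv_pos (convex_Ioi 0)
    (fun _ hs => (hG.hasDerivAt_mul hs).continuousAt.continuousWithinAt)
    fun s hs => hG.deriv_mul_pos s (by simpa using hs)

theorem exists_mul_eq (hG : IsRadialWeight G) (ht : 0 < t) : ∃ s, 0 < s ∧ s * G s = t := by
  simpa using hG.image_mul.ge ht

theorem tendsto_mul_zero (hG : IsRadialWeight G) :
    Tendsto (fun s => s * G s) (𝓝[>] 0) (𝓝 0) := by
  refine tendsto_order.2 ⟨fun a ha => ?_, fun a ha => ?_⟩
  · filter_upwards [self_mem_nhdsWithin] with s hs using ha.trans (hG.mul_pos hs)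
  · obtain ⟨p, hp, rfl⟩ := hG.exists_mul_eq ha
    filter_upwards [Ioo_mem_nhdsGT hp] with s hs using hG.strictMonoOn_mul hs.1 hp hs.2

theorem tendsto_mul_atTop (hG : IsRadialWeight G) :
    Tendsto (fun s => s * G s) atTop atTop := by
  refine tendsto_atTop.2 fun a => ?_
  obtain ⟨p, hp, hpa⟩ := hG.exists_mul_eq (lt_max_of_lt_right one_pos : 0 < max a 1)
  filter_upwards [eventually_ge_atTop p] with s hs
  exact (le_max_left a 1).trans
    (hpa.symm.trans_le (hG.strictMonoOn_mul.monotoneOn hp (hp.trans_le hs) hs))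

theorem of_tendsto (hpos : ∀ s, 0 < s → 0 < G s) (hdiff : ContDiffOn ℝ 1 G (Ioi 0))
    (hderiv : ∀ s, 0 < s → 0 < G s + s * deriv G s)
    (hzero : Tendsto (fun s => s * G s) (𝓝[>] 0) (𝓝 0))
    (htop : Tendsto (fun s => s * G s) atTop atTop) : IsRadialWeight G where
  pos := hpos
  contDiffOn := hdiff
  deriv_mul_pos s hs := by
    have hd : DifferentiableAt ℝ G s :=
      (hdiff.differentiableOn one_ne_zero).differentiableAt (Ioi_mem_nhds hs)
    simpa [((hasDerivAt_id' s).fun_mul hd.hasDerivAt).deriv] using hderiv s hs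
  image_mul := by
    refine Subset.antisymm (image_subset_iff.2 fun s hs => _root_.mul_pos hs (hpos s hs)) ?_
    exact isPreconnected_Ioi.intermediate_value_Ioi (le_principal_iff.2 self_mem_nhdsWithin)
      (le_principal_iff.2 (Ioi_mem_atTop 0)) (continuousOn_id.mul hdiff.continuousOn) hzero htop

theorem one : IsRadialWeight fun _ => 1 :=
  of_tendsto (by simp) contDiffOn_const (by simp)
    ((tendsto_nhdsWithin_of_tendsto_nhds tendsto_id).congr fun s => (mul_one s).symm)
    (tendsto_id.congr fun s => (mul_one s).symm)

theorem add (hG : IsRadialWeight G) (hH : IsRadialWeight H) : IsRadialWeight (G + H) := by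
  refine of_tendsto (fun s hs => add_pos (hG.pos s hs) (hH.pos s hs))
    (hG.contDiffOn.add hH.contDiffOn) (fun s hs => ?_) ?_ ?_
  · rw [deriv_add (hG.differentiableAt hs) (hH.differentiableAt hs), Pi.add_apply]
    linarith [hG.add_mul_deriv_pos hs, hH.add_mul_deriv_pos hs]
  · simpa [mul_add] using hG.tendsto_mul_zero.add hH.tendsto_mul_zero
  · simpa [mul_add] using hG.tendsto_mul_atTop.atTop_add_atTop hH.tendsto_mul_atTop

theorem sum {ι : Type*} [Fintype ι] [Nonempty ι] {G : ι → ℝ → ℝ}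
    (hG : ∀ i, IsRadialWeight (G i)) : IsRadialWeight (∑ i, G i) :=
  Finset.sum_induction_nonempty G IsRadialWeight (fun _ _ => add) Finset.univ_nonempty
    fun i _ => hG i

theorem sqrt_pos (hG : IsRadialWeight G) (hs : 0 < s) : 0 < √(G s) :=
  Real.sqrt_pos.2 (hG.pos s hs)

theorem hasDerivAt_sqrt (hG : IsRadialWeight G) (hs : 0 < s) :
    HasDerivAt (fun σ => √(G σ)) (deriv G s / (2 * √(G s))) s :=
  (hG.differentiableAt hs).hasDerivAt.sqrt (hG.pos s hs).ne'

theorem sqrt (hG : IsRadialWeight G) : IsRadialWeight fun s => √(G s) := by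
  have hroot : (fun s => s * √(G s)) =ᶠ[𝓟 (Ioi 0)] fun s => √(s * (s * G s)) := by
    filter_upwards [mem_principal_self _] with s hs
    rw [← mul_assoc, Real.sqrt_mul (mul_self_nonneg s), Real.sqrt_mul_self (mem_Ioi.1 hs).le]
  refine of_tendsto (fun s hs => hG.sqrt_pos hs)
    (hG.contDiffOn.sqrt fun s hs => (hG.pos s hs).ne') (fun s hs => ?_) ?_ ?_
  · have hq := hG.sqrt_pos hs
    have hsq := Real.mul_self_sqrt (hG.pos s hs).le
    rw [(hG.hasDerivAt_sqrt hs).deriv]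
    have : 0 < (G s + (G s + s * deriv G s)) / (2 * √(G s)) :=
      div_pos (add_pos (hG.pos s hs) (hG.add_mul_deriv_pos hs)) (by positivity)
    refine this.trans_eq ?_
    field_simp
    linear_combination -2 * hsq
  · refine Tendsto.congr' (hroot.symm.filter_mono (le_principal_iff.2 self_mem_nhdsWithin)) ?_
    simpa using ((tendsto_nhdsWithin_of_tendsto_nhds tendsto_id).mul hG.tendsto_mul_zero).sqrt
  · refine Tendsto.congr' (hroot.symm.filter_mono (le_principal_iff.2 (Ioi_mem_atTop 0))) ?_
    exact Real.tendsto_sqrt_atTop.comp (tendsto_id.atTop_mul_atTop₀ hG.tendsto_mul_atTop)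

theorem radialInv_pos (hG : IsRadialWeight G) (ht : 0 < t) : 0 < radialInv G t :=
  Function.invFunOn_mem (hG.image_mul.ge ht)

theorem radialInv_mul_self (hG : IsRadialWeight G) (ht : 0 < t) :
    radialInv G t * G (radialInv G t) = t :=
  Function.invFunOn_eq (hG.image_mul.ge ht)

theorem radialInv_apply_mul (hG : IsRadialWeight G) (hs : 0 < s) : radialInv G (s * G s) = s :=
  hG.strictMonoOn_mul.injOn.leftInvOn_invFunOn hs

theorem continuousAt_radialInv (hG : IsRadialWeight G) (ht : 0 < t) :
    ContinuousAt (radialInv G) t := by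
  have hmono : MonotoneOn (radialInv G) (Ioi 0) := fun a ha b hb hab => by
    rw [← hG.strictMonoOn_mul.le_iff_le (hG.radialInv_pos ha) (hG.radialInv_pos hb)]
    simpa only [hG.radialInv_mul_self ha, hG.radialInv_mul_self hb] using hab
  have himage : Ioi 0 ⊆ radialInv G '' Ioi 0 := fun s hs =>
    ⟨s * G s, hG.mul_pos hs, hG.radialInv_apply_mul hs⟩
  exact continuousAt_of_monotoneOn_of_image_mem_nhds hmono (Ioi_mem_nhds ht)
    (mem_of_superset (Ioi_mem_nhds (hG.radialInv_pos ht)) himage)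

theorem continuousOn_radialInv (hG : IsRadialWeight G) : ContinuousOn (radialInv G) (Ioi 0) :=
  fun _ ht => (hG.continuousAt_radialInv ht).continuousWithinAt

theorem hasDerivAt_radialInv (hG : IsRadialWeight G) (ht : 0 < t) :
    HasDerivAt (radialInv G) (G (radialInv G t) + radialInv G t * deriv G (radialInv G t))⁻¹ t :=
  (hG.hasDerivAt_mul (hG.radialInv_pos ht)).of_local_left_inverse (hG.continuousAt_radialInv ht)
    (hG.add_mul_deriv_pos (hG.radialInv_pos ht)).ne'
    (by filter_upwards [Ioi_mem_nhds ht] with y hy using hG.radialInv_mul_self hy)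

theorem continuousOn_add_mul_deriv (hG : IsRadialWeight G) :
    ContinuousOn (fun s => G s + s * deriv G s) (Ioi 0) :=
  hG.contDiffOn.continuousOn.add (continuousOn_id.mul hG.continuousOn_deriv)

theorem contDiff_mul_radialProfile (hG : IsRadialWeight G) (hH : IsRadialWeight H)
    (hle : ∀ s, 0 < s → G s ≤ H s)
    (hle' : ∀ s, 0 < s → G s + s * deriv G s ≤ H s + s * deriv H s) {c : ℝ} (hc : 0 < c) :
    ContDiff ℝ 1 fun τ => radialProfile H c τ * G (radialProfile H c τ) := by
  set r := (Ioi 0).indicator (radialInv H)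
  have hr : ∀ y, 0 < y → r y = radialInv H y := fun y hy => indicator_of_mem hy _
  have hmaps : MapsTo (radialInv H) (Ioi 0) (Ioi 0) := fun y hy => hH.radialInv_pos hy
  refine contDiff_comp_mul_sq (K := fun y => r y * G (r y))
    (K' := fun y => (G (radialInv H y) + radialInv H y * deriv G (radialInv H y)) *
      (H (radialInv H y) + radialInv H y * deriv H (radialInv H y))⁻¹)
    hc (by simp [r]) (fun y hy => ?_) ?_ (fun y hy => ?_) fun y hy => ?_
  · refine ((hG.hasDerivAt_mul (hH.radialInv_pos hy)).comp y
      (hH.hasDerivAt_radialInv hy)).congr_of_eventuallyEq ?_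
    filter_upwards [Ioi_mem_nhds hy] with z hz
    simp only [hr z hz, Function.comp_apply]
  · exact (hG.continuousOn_add_mul_deriv.comp hH.continuousOn_radialInv hmaps).mul
      ((hH.continuousOn_add_mul_deriv.comp hH.continuousOn_radialInv hmaps).inv₀
        fun y hy => (hH.add_mul_deriv_pos (hmaps hy)).ne')
  · have hpos := hH.radialInv_pos hy
    simp only [hr y hy]
    rw [abs_of_pos (hG.mul_pos hpos)]
    calc radialInv H y * G (radialInv H y) ≤ radialInv H y * H (radialInv H y) := by
          gcongr; exact hle _ hpos
      _ = y := hH.radialInv_mul_self hy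
  · have hpos := hH.radialInv_pos hy
    rw [← div_eq_mul_inv,
      abs_of_pos (div_pos (hG.add_mul_deriv_pos hpos) (hH.add_mul_deriv_pos hpos)),
      div_le_one (hH.add_mul_deriv_pos hpos)]
    exact hle' _ hpos

theorem exists_profile {ι : Type*} [Finite ι] [Nonempty ι] {G : ι → ℝ → ℝ}
    (hG : ∀ i, IsRadialWeight (G i)) (hs : 0 < s) :
    ∃ ρ : ℝ → ℝ, ρ 0 = 0 ∧ ρ 1 = s ∧ (∀ τ, 0 ≤ ρ τ) ∧
      ∀ i, ContDiff ℝ 1 fun τ => ρ τ * G i (ρ τ) := by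
  cases nonempty_fintype ι
  have hH := sum hG
  set H := ∑ i, G i with hHdef
  have hc : 0 < s * H s := hH.mul_pos hs
  refine ⟨radialProfile H (s * H s), by simp [radialProfile], ?_,
    fun τ => indicator_nonneg (fun y hy => (hH.radialInv_pos hy).le) _, fun i => ?_⟩
  · simp [radialProfile, hc, hH.radialInv_apply_mul hs]
  · refine (hG i).contDiff_mul_radialProfile hH (fun s hs => ?_) (fun s hs => ?_) hc
    · rw [hHdef, Finset.sum_apply]
      exact Finset.single_le_sum (f := fun j => G j s) (fun j _ => ((hG j).pos s hs).le)
        (Finset.mem_univ i)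
    · rw [hHdef, deriv_sum fun j _ => (hG j).differentiableAt hs, Finset.sum_apply,
        Finset.mul_sum, ← Finset.sum_add_distrib]
      exact Finset.single_le_sum (f := fun j => G j s + s * deriv (G j) s)
        (fun j _ => ((hG j).add_mul_deriv_pos hs).le) (Finset.mem_univ i)

section Lam

variable {φ : ℝ → ℝ}

theorem Lam_mul_sqrt (hφ : IsRadialWeight φ) (hs : 0 < s) :
    Lam φ (s * √(φ s)) = -(s * deriv φ s / (s * deriv φ s + 2 * φ s)) := by
  have : lamParam φ (s * √(φ s)) = s := hφ.sqrt.radialInv_apply_mul hs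
  rw [Lam, this]

theorem mul_deriv_add_two_mul_pos (hφ : IsRadialWeight φ) (hs : 0 < s) :
    0 < s * deriv φ s + 2 * φ s := by
  linarith [hφ.add_mul_deriv_pos hs, hφ.pos s hs]

theorem Lam_sq_lt_one (hφ : IsRadialWeight φ) (ht : 0 < t) : Lam φ t ^ 2 < 1 := by
  obtain ⟨s, hs, rfl⟩ := hφ.sqrt.exists_mul_eq ht
  have hden := hφ.mul_deriv_add_two_mul_pos hs
  have hpos := hφ.pos s hs
  rw [hφ.Lam_mul_sqrt hs, neg_sq, sq_lt_one_iff_abs_lt_one, abs_div, abs_of_pos hden,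
    div_lt_one hden, abs_lt]
  constructor <;> linarith [hφ.add_mul_deriv_pos hs]

theorem Lam_sq_le_LamInfSq (hφ : IsRadialWeight φ) (ht : 0 < t) : Lam φ t ^ 2 ≤ LamInfSq φ := by
  refine le_csSup ⟨1, ?_⟩ ⟨t, ht, rfl⟩
  rintro _ ⟨t, ht, rfl⟩
  exact (hφ.Lam_sq_lt_one ht).le

theorem continuousOn_Lam (hφ : IsRadialWeight φ) : ContinuousOn (Lam φ) (Ioi 0) := by
  have hmaps : MapsTo (lamParam φ) (Ioi 0) (Ioi 0) := fun t ht => hφ.sqrt.radialInv_pos ht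
  have hparam : ContinuousOn (lamParam φ) (Ioi 0) := hφ.sqrt.continuousOn_radialInv
  have hnum := hparam.mul (hφ.continuousOn_deriv.comp hparam hmaps)
  have hden := hnum.add
    ((continuousOn_const (c := 2)).mul (hφ.contDiffOn.continuousOn.comp hparam hmaps))
  exact (hnum.div hden fun t ht => (hφ.mul_deriv_add_two_mul_pos (hmaps ht)).ne').neg

end Lam

end IsRadialWeight

section RadialMap

variable {F : Type*} [NormedAddCommGroup F] [InnerProductSpace ℝ F] {G φ : ℝ → ℝ} {U : F}

local notation "⟪" x ", " y "⟫" => inner ℝ x y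

/-- The radial map `U ↦ G(|U|) U`, so that `phiMul φ u` is `radialMap φ ∘ u`. -/
def radialMap (G : ℝ → ℝ) (U : F) : F := G ‖U‖ • U

@[simp] theorem radialMap_zero : radialMap G (0 : F) = 0 := smul_zero _

theorem inner_normalize_self (hU : U ≠ 0) : ⟪‖U‖⁻¹ • U, ‖U‖⁻¹ • U⟫ = 1 := by
  rw [real_inner_self_eq_norm_sq, norm_smul, norm_inv, norm_norm,
    inv_mul_cancel₀ (norm_ne_zero_iff.2 hU), one_pow]

theorem hasFDerivAt_norm_of_ne_zero (hU : U ≠ 0) :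
    HasFDerivAt (fun V : F => ‖V‖) (‖U‖⁻¹ • innerSL ℝ U) U := by
  have h := (hasStrictFDerivAt_norm_sq U).hasFDerivAt.sqrt (pow_ne_zero 2 (norm_ne_zero_iff.2 hU))
  simp only [Real.sqrt_sq (norm_nonneg _)] at h
  convert h using 1
  ext ζ
  simp only [smul_apply, innerSL_apply_apply, smul_eq_mul, nsmul_eq_mul]
  field_simp
  norm_num

theorem hasFDerivAt_radialMap (hG : DifferentiableAt ℝ G ‖U‖) (hU : U ≠ 0) :
    HasFDerivAt (radialMap G) (G ‖U‖ • ContinuousLinearMap.id ℝ F +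
      (deriv G ‖U‖ • ‖U‖⁻¹ • innerSL ℝ U).smulRight U) U :=
  (hG.hasDerivAt.comp_hasFDerivAt U (hasFDerivAt_norm_of_ne_zero hU)).smul (hasFDerivAt_id U)

theorem fderiv_radialMap_apply (hG : DifferentiableAt ℝ G ‖U‖) (hU : U ≠ 0) (ζ : F) :
    fderiv ℝ (radialMap G) U ζ =
      G ‖U‖ • ζ + (‖U‖ * deriv G ‖U‖ * ⟪‖U‖⁻¹ • U, ζ⟫) • ‖U‖⁻¹ • U := by
  have hnorm : ‖U‖ ≠ 0 := norm_ne_zero_iff.2 hU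
  rw [(hasFDerivAt_radialMap hG hU).fderiv]
  simp only [add_apply, smul_apply, ContinuousLinearMap.smulRight_apply,
    ContinuousLinearMap.id_apply, innerSL_apply_apply, smul_eq_mul, real_inner_smul_left, smul_smul]
  congr 2
  field_simp

namespace IsRadialWeight

theorem contDiffOn_radialMap (hG : IsRadialWeight G) :
    ContDiffOn ℝ 1 (radialMap G : F → F) {0}ᶜ :=
  (hG.contDiffOn.comp (fun _ hU => (contDiffAt_norm ℝ hU).contDiffWithinAt)
    fun V (hV : V ≠ 0) => norm_pos_iff.2 hV).smul contDiffOn_id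

theorem differentiableAt_radialMap (hG : IsRadialWeight G) (hU : U ≠ 0) :
    DifferentiableAt ℝ (radialMap G) U :=
  (hasFDerivAt_radialMap (hG.differentiableAt (norm_pos_iff.2 hU)) hU).differentiableAt

theorem continuousOn_fderiv_radialMap_apply (hG : IsRadialWeight G) :
    ContinuousOn (fun p : F × F => fderiv ℝ (radialMap G) p.1 p.2) {p | p.1 ≠ 0} :=
  ((hG.contDiffOn_radialMap.continuousOn_fderiv_of_isOpen isOpen_compl_singleton le_rfl).comp
    continuousOn_fst fun _ hp => hp).clm_apply continuousOn_snd

theorem norm_radialMap (hG : IsRadialWeight G) (U : F) : ‖radialMap G U‖ = ‖U‖ * G ‖U‖ := by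
  rcases eq_or_ne U 0 with rfl | hU
  · simp
  · rw [radialMap, norm_smul, Real.norm_of_nonneg (hG.pos _ (norm_pos_iff.2 hU)).le, mul_comm]

theorem radialMap_eq_zero_iff (hG : IsRadialWeight G) : radialMap G U = 0 ↔ U = 0 := by
  refine ⟨fun h => by_contra fun hU => ?_, fun h => by simp [h]⟩
  exact (hG.mul_pos (norm_pos_iff.2 hU)).ne' (by rw [← hG.norm_radialMap, h, norm_zero])

theorem normalize_radialMap (hG : IsRadialWeight G) (U : F) :
    ‖radialMap G U‖⁻¹ • radialMap G U = ‖U‖⁻¹ • U := by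
  rcases eq_or_ne U 0 with rfl | hU
  · simp
  · have hpos := hG.pos _ (norm_pos_iff.2 hU)
    rw [hG.norm_radialMap, radialMap, smul_smul]
    congr 1
    field_simp

end IsRadialWeight

/-- The quadratic form in `ξ` that underlies all the ellipticity conditions, written as a product:
`⟨A (ξ + l ⟨ω, ξ⟩ ω), ξ - l ⟨ω, ξ⟩ ω⟩`; the expanded form is `phiForm_eq`. Here `ω` is the direction
of `v` and `l` is `Λ(|v|)`. -/
noncomputable def phiForm (A : F →L[ℝ] F) (l : ℝ) (ω ξ : F) : ℝ :=
  ⟪A (ξ + (l * ⟪ω, ξ⟫) • ω), ξ - (l * ⟪ω, ξ⟫) • ω⟫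

theorem phiForm_eq (A : F →L[ℝ] F) (l : ℝ) (ω ξ : F) :
    phiForm A l ω ξ = ⟪A ξ, ξ⟫ + l * (⟪A ω, ξ⟫ - ⟪A ξ, ω⟫) * ⟪ω, ξ⟫
      - l ^ 2 * ⟪A ω, ω⟫ * ⟪ω, ξ⟫ ^ 2 := by
  simp only [phiForm, map_add, map_smul, inner_add_left, inner_sub_right, real_inner_smul_left,
    real_inner_smul_right]
  ring

theorem phiForm_sub_smul_id (A : F →L[ℝ] F) (κ l : ℝ) (ω ξ : F) :
    phiForm (A - κ • ContinuousLinearMap.id ℝ F) l ω ξ =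
      phiForm A l ω ξ - κ * (‖ξ‖ ^ 2 - (l * ⟪ω, ξ⟫) ^ 2 * ‖ω‖ ^ 2) := by
  simp only [phiForm_eq, sub_apply, smul_apply, ContinuousLinearMap.id_apply, inner_sub_left,
    real_inner_smul_left, real_inner_self_eq_norm_sq, real_inner_comm ω ξ]
  ring

theorem phiForm_sub_mul_sq_norm_le {κ : ℝ} (hκ : 0 ≤ κ) (A : F →L[ℝ] F) (l : ℝ) (ω ξ : F) :
    phiForm A l ω ξ - κ * ‖ξ‖ ^ 2 ≤ phiForm (A - κ • ContinuousLinearMap.id ℝ F) l ω ξ := by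
  rw [phiForm_sub_smul_id]
  linarith [mul_nonneg hκ (mul_nonneg (sq_nonneg (l * ⟪ω, ξ⟫)) (sq_nonneg ‖ω‖))]

theorem mul_sq_norm_le_phiForm {A : F →L[ℝ] F} {κ l L : ℝ} (hκ : 0 ≤ κ) (hl : l ^ 2 ≤ L)
    {ω ξ : F} (hω : ‖ω‖ = 1)
    (h : 0 ≤ phiForm (A - κ • ContinuousLinearMap.id ℝ F) l ω ξ) :
    κ * (1 - L) * ‖ξ‖ ^ 2 ≤ phiForm A l ω ξ := by
  have hcs : ⟪ω, ξ⟫ ^ 2 ≤ ‖ξ‖ ^ 2 := by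
    simpa [hω] using sq_le_sq' (neg_le_of_abs_le (abs_real_inner_le_norm ω ξ))
      (real_inner_le_norm ω ξ)
  have hproj : (l * ⟪ω, ξ⟫) ^ 2 ≤ L * ‖ξ‖ ^ 2 := by
    rw [mul_pow]
    exact mul_le_mul hl hcs (sq_nonneg _) ((sq_nonneg l).trans hl)
  rw [phiForm_sub_smul_id, hω] at h
  linarith [mul_le_mul_of_nonneg_left hproj hκ]

namespace IsRadialWeight

/-- The substitution `V = √φ(|U|) U` turns the form of the energy into `phiForm`: with `ξ` the
derivative of `V`, the vectors `ξ ± Λ ⟨ω, ξ⟩ ω` are multiples of `ζ` and of the derivative of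
`φ(|U|) U`. -/
theorem inner_fderiv_radialMap (hφ : IsRadialWeight φ) (A : F →L[ℝ] F) (hU : U ≠ 0) (ζ : F) :
    ⟪A ζ, fderiv ℝ (radialMap φ) U ζ⟫ =
      phiForm A (Lam φ ‖radialMap (fun s => √(φ s)) U‖)
        (‖radialMap (fun s => √(φ s)) U‖⁻¹ • radialMap (fun s => √(φ s)) U)
        (fderiv ℝ (radialMap fun s => √(φ s)) U ζ) := by
  have hs : 0 < ‖U‖ := norm_pos_iff.2 hU
  rw [hφ.sqrt.normalize_radialMap, hφ.sqrt.norm_radialMap, hφ.Lam_mul_sqrt hs,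
    fderiv_radialMap_apply (hφ.differentiableAt hs) hU,
    fderiv_radialMap_apply (hφ.sqrt.differentiableAt hs) hU, (hφ.hasDerivAt_sqrt hs).deriv]
  set s := ‖U‖
  set ω := s⁻¹ • U
  set p := ⟪ω, ζ⟫ with hp
  set q := √(φ s)
  have hq : 0 < q := hφ.sqrt_pos hs
  have hφq : φ s = q ^ 2 := (Real.sq_sqrt (hφ.pos s hs).le).symm
  have hω : ⟪ω, ω⟫ = 1 := inner_normalize_self hU
  have hden := (hφ.mul_deriv_add_two_mul_pos hs).ne'
  set ξ := q • ζ + (s * (deriv φ s / (2 * q)) * p) • ω with hξ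
  have hproj : -(s * deriv φ s / (s * deriv φ s + 2 * φ s)) * ⟪ω, ξ⟫ =
      -(s * deriv φ s * p / (2 * q)) := by
    rw [hξ, inner_add_right, real_inner_smul_right, real_inner_smul_right, hω, ← hp]
    rw [hφq] at hden ⊢
    field_simp
    ring
  have hadd : ξ + (-(s * deriv φ s * p / (2 * q))) • ω = q • ζ := by
    rw [hξ, add_assoc, ← add_smul, add_eq_left]
    convert zero_smul ℝ ω using 2
    ring
  have hsub : ξ - (-(s * deriv φ s * p / (2 * q))) • ω =
      q⁻¹ • (φ s • ζ + (s * deriv φ s * p) • ω) := by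
    rw [hξ, hφq]
    match_scalars <;> field_simp
    ring
  rw [phiForm, hproj, hadd, hsub, map_smul, real_inner_smul_left, real_inner_smul_right,
    mul_inv_cancel_left₀ hq.ne']

theorem exists_radialMap_sqrt_eq (hφ : IsRadialWeight φ) {t : ℝ} (ht : 0 < t) {ω : F}
    (hω : ‖ω‖ = 1) : ∃ U, U ≠ 0 ∧ radialMap (fun s => √(φ s)) U = t • ω := by
  obtain ⟨s, hs, rfl⟩ := hφ.sqrt.exists_mul_eq ht
  refine ⟨s • ω, smul_ne_zero hs.ne' (norm_ne_zero_iff.1 (by simp [hω])), ?_⟩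
  rw [radialMap, norm_smul, hω, Real.norm_of_nonneg hs.le, mul_one, smul_smul, mul_comm]

theorem surjective_fderiv_radialMap (hG : IsRadialWeight G) (hU : U ≠ 0) :
    Function.Surjective (fderiv ℝ (radialMap G) U) := by
  intro ξ
  have hs : 0 < ‖U‖ := norm_pos_iff.2 hU
  have hg := (hG.pos _ hs).ne'
  have hd := (hG.add_mul_deriv_pos hs).ne'
  refine ⟨(G ‖U‖)⁻¹ • (ξ - (‖U‖ * deriv G ‖U‖ / (G ‖U‖ + ‖U‖ * deriv G ‖U‖) *
    ⟪‖U‖⁻¹ • U, ξ⟫) • ‖U‖⁻¹ • U), ?_⟩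
  rw [fderiv_radialMap_apply (hG.differentiableAt hs) hU, real_inner_smul_right,
    inner_sub_right, real_inner_smul_right, inner_normalize_self hU]
  generalize ‖U‖⁻¹ • U = ω
  match_scalars <;> field_simp
  ring

theorem phiForm_nonneg (hφ : IsRadialWeight φ) {A : F →L[ℝ] F}
    (hA : ∀ U ζ : F, U ≠ 0 → 0 ≤ ⟪A ζ, fderiv ℝ (radialMap φ) U ζ⟫) {t : ℝ} (ht : 0 < t) {ω : F}
    (hω : ‖ω‖ = 1) (ξ : F) : 0 ≤ phiForm A (Lam φ t) ω ξ := by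
  obtain ⟨U, hU, hV⟩ := hφ.exists_radialMap_sqrt_eq ht hω
  obtain ⟨ζ, rfl⟩ := hφ.sqrt.surjective_fderiv_radialMap hU ξ
  have hnorm : ‖t • ω‖ = t := by rw [norm_smul, hω, Real.norm_of_nonneg ht.le, mul_one]
  simpa only [hφ.inner_fderiv_radialMap A hU, hV, hnorm, inv_smul_smul₀ ht.ne'] using hA U ζ hU

end IsRadialWeight

end RadialMap

section Coefficients

variable {n m : ℕ}

theorem reInner_eq_inner (x y : CSpace m) : reInner x y = inner ℝ x y := by
  simp [reInner, PiLp.inner_apply]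

/-- A complex matrix as a real-linear operator: only the real inner product `Re ⟨·, ·⟩` of `ℂᵐ`
enters the ellipticity conditions, so that `ℂᵐ` can be treated as a real Hilbert space. -/
noncomputable def matOp : Matrix (Fin m) (Fin m) ℂ →ₗ[ℝ] CSpace m →L[ℝ] CSpace m :=
  ContinuousLinearMap.restrictScalarsₗ ℂ (CSpace m) (CSpace m) ℝ ℝ ∘ₗ
    (Matrix.toEuclideanLin ≪≫ₗ LinearMap.toContinuousLinearMap).toLinearMap.restrictScalars ℝ

theorem matAct_eq_matOp (M : Matrix (Fin m) (Fin m) ℂ) (v : CSpace m) :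
    matAct M v = matOp M v := rfl

theorem matOp_one : matOp (1 : Matrix (Fin m) (Fin m) ℂ) = ContinuousLinearMap.id ℝ _ := by
  ext; simp [matOp]

theorem inner_matOp_conjTranspose (M : Matrix (Fin m) (Fin m) ℂ) (x y : CSpace m) :
    inner ℝ (matOp M.conjTranspose x) y = inner ℝ x (matOp M y) := by
  rw [← matAct_eq_matOp, ← matAct_eq_matOp, ← reInner_eq_inner, ← reInner_eq_inner, reInner,
    matAct, Matrix.toEuclideanLin_conjTranspose_eq_adjoint, LinearMap.adjoint_inner_left]
  rfl

theorem locallyIntegrableOn_finsetSum {X E ι : Type*} [TopologicalSpace X] [MeasurableSpace X]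
    [NormedAddCommGroup E] {μ : Measure X} {S : Set X} {f : ι → X → E} (s : Finset ι)
    (hf : ∀ i ∈ s, LocallyIntegrableOn (f i) S μ) : LocallyIntegrableOn (∑ i ∈ s, f i) S μ :=
  Finset.sum_induction f (LocallyIntegrableOn · S μ) (fun _ _ => .add)
    (locallyIntegrableOn_zero (ε'' := E)) hf

theorem locallyIntegrableOn_matOp {X : Type*} [TopologicalSpace X] [MeasurableSpace X]
    {μ : Measure X} {S : Set X} {M : X → Matrix (Fin m) (Fin m) ℂ}
    (hM : ∀ i j, LocallyIntegrableOn (fun x => M x i j) S μ) :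
    LocallyIntegrableOn (fun x => matOp (M x)) S μ := by
  let L (i j : Fin m) : ℂ →L[ℝ] CSpace m →L[ℝ] CSpace m :=
    (matOp ∘ₗ Matrix.singleLinearMap ℝ i j).toContinuousLinearMap
  have hsum : (fun x => matOp (M x)) = ∑ i, ∑ j, L i j ∘ fun x => M x i j := by
    funext x
    conv_lhs => rw [Matrix.matrix_eq_sum_single (M x)]
    simp [L]
  rw [hsum]
  exact locallyIntegrableOn_finsetSum _ fun i _ => locallyIntegrableOn_finsetSum _ fun j _ =>
    (L i j).locallyIntegrableOn_comp (hM i j)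

/-- The operators `𝒜^h(x)`, acting on `ℂᵐ` as a real Hilbert space. -/
noncomputable def diagOp (a : Fin n → RSpace n → Matrix (Fin m) (Fin m) ℂ) :
    Fin n → RSpace n → CSpace m →L[ℝ] CSpace m :=
  fun h x => matOp (a h x)

/-- The operators `𝒜^h - κ I`, the coefficients of `A - κ Δ`. -/
noncomputable def shiftOp (A : Fin n → RSpace n → CSpace m →L[ℝ] CSpace m) (κ : ℝ) :
    Fin n → RSpace n → CSpace m →L[ℝ] CSpace m :=
  fun h x => A h x - κ • ContinuousLinearMap.id ℝ (CSpace m)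

/-- The integrand `∑ Re ⟨𝒜^h ∂_h u, ∂_h w⟩` of the energy of an operator `∂_h (𝒜^h ∂_h)`. -/
noncomputable def energyDensity (A : Fin n → RSpace n → CSpace m →L[ℝ] CSpace m)
    (u w : RSpace n → CSpace m) (x : RSpace n) : ℝ :=
  ∑ h, inner ℝ (A h x (pd h u x)) (pd h w x)

/-- The integrand of the integral `Φ`-ellipticity condition of an operator `∂_h (𝒜^h ∂_h)`, up to
the null set of those zeros of `v` at which `∇v ≠ 0`. -/
noncomputable def phiDensity (φ : ℝ → ℝ) (A : Fin n → RSpace n → CSpace m →L[ℝ] CSpace m)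
    (v : RSpace n → CSpace m) (x : RSpace n) : ℝ :=
  ∑ h, phiForm (A h x) (Lam φ ‖v x‖) (‖v x‖⁻¹ • v x) (pd h v x)

/-- Uniform positivity of `phiForm` for each of the operators `𝒜^h(x)` separately. It is what all
the conditions amount to for `∂_h (𝒜^h ∂_h)`. -/
def DiagPhiElliptic (φ : ℝ → ℝ) (Ω : Set (RSpace n))
    (A : Fin n → RSpace n → CSpace m →L[ℝ] CSpace m) : Prop :=
  ∃ κ : ℝ, 0 < κ ∧ ∀ᵐ x ∂(volume.restrict Ω), ∀ (h : Fin n) (ω ξ : CSpace m) (t : ℝ),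
    ‖ω‖ = 1 → 0 < t → κ * ‖ξ‖ ^ 2 ≤ phiForm (A h x) (Lam φ t) ω ξ

variable {φ : ℝ → ℝ} {Ω : Set (RSpace n)} {a : Fin n → RSpace n → Matrix (Fin m) (Fin m) ℂ}

theorem energy_diagTensor (u w : RSpace n → CSpace m) :
    energy Ω (diagTensor a) u w = ∫ x in Ω, energyDensity (diagOp a) u w x := by
  refine integral_congr_ae (Eventually.of_forall fun x => Finset.sum_congr rfl fun h _ => ?_)
  rw [Finset.sum_eq_single h]
  · simp only [diagTensor, if_true, reInner_eq_inner, matAct_eq_matOp, diagOp]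
  · intro k _ hk
    simp [diagTensor, hk.symm, reInner_eq_inner, matAct_eq_matOp]
  · simp

theorem subLaplacian_diagTensor (κ : ℝ) :
    subLaplacian (diagTensor a) κ = diagTensor fun h x => a h x - (κ : ℂ) • 1 := by
  ext h k x : 3
  by_cases hk : h = k <;> simp [subLaplacian, diagTensor, hk]

theorem diagOp_sub_smul_one (κ : ℝ) :
    diagOp (fun h x => a h x - (κ : ℂ) • 1) = shiftOp (diagOp a) κ := by
  funext h x
  simp only [diagOp, shiftOp, map_sub, Complex.coe_smul, map_smul, matOp_one]

theorem phiForm_matOp (M : Matrix (Fin m) (Fin m) ℂ) (l : ℝ) (ω ξ : CSpace m) :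
    phiForm (matOp M) l ω ξ = reInner (matAct M ξ) ξ +
      l * reInner (matAct (M - M.conjTranspose) ω) ξ * reInner ω ξ -
      l ^ 2 * reInner (matAct M ω) ω * reInner ω ξ * reInner ω ξ := by
  simp only [phiForm_eq, reInner_eq_inner, matAct_eq_matOp, map_sub, sub_apply, inner_sub_left,
    inner_matOp_conjTranspose, real_inner_comm ω (matOp M ξ)]
  ring

theorem phiIntegrand_diagTensor {v : RSpace n → CSpace m} {x : RSpace n}
    (hx : v x = 0 → fderiv ℝ v x = 0) :
    phiIntegrand φ (diagTensor a) v x = phiDensity φ (diagOp a) v x := by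
  by_cases h0 : v x = 0
  · simp [phiIntegrand, phiDensity, phiForm, pd, h0, hx h0]
  rw [phiIntegrand, indicator_of_mem (by exact h0)]
  refine Finset.sum_congr rfl fun h _ => ?_
  rw [Finset.sum_eq_single h]
  · have hv : ‖v x‖ ≠ 0 := norm_ne_zero_iff.2 h0
    simp only [diagTensor, if_true, diagOp, phiForm_matOp, reInner_eq_inner, matAct_eq_matOp,
      map_smul, real_inner_smul_left, real_inner_smul_right]
    field_simp
  · intro k _ hk
    simp [diagTensor, hk, hk.symm, reInner_eq_inner, matAct_eq_matOp]
  · simp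

theorem matOp_symbolMatrix_diagTensor (x q : RSpace n) :
    matOp (symbolMatrix (diagTensor a) x q) = ∑ h, q h ^ 2 • diagOp a h x := by
  simp only [symbolMatrix, diagTensor, map_sum, Complex.coe_smul, map_smul, smul_ite,
    smul_zero, Finset.sum_ite_eq, Finset.mem_univ, if_true, diagOp, sq]

theorem phiForm_sum_smul {F ι : Type*} [NormedAddCommGroup F] [InnerProductSpace ℝ F]
    (s : Finset ι) (c : ι → ℝ) (A : ι → F →L[ℝ] F) (l : ℝ) (ω ξ : F) :
    phiForm (∑ i ∈ s, c i • A i) l ω ξ = ∑ i ∈ s, c i * phiForm (A i) l ω ξ := by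
  simp only [phiForm, sum_apply, smul_apply, sum_inner, real_inner_smul_left]

theorem weakForm_diagTensor (x q : RSpace n) (l : ℝ) (ω ξ : CSpace m) :
    reInner (matAct (symbolMatrix (diagTensor a) x q) ξ) ξ
      - l ^ 2 * reInner (matAct (symbolMatrix (diagTensor a) x q) ω) ω * reInner ξ ω ^ 2
      + l * (reInner (matAct (symbolMatrix (diagTensor a) x q) ω) ξ
        - reInner (matAct (symbolMatrix (diagTensor a) x q) ξ) ω) * reInner ξ ω =
    ∑ h, q h ^ 2 * phiForm (diagOp a h x) l ω ξ := by
  rw [← phiForm_sum_smul, ← matOp_symbolMatrix_diagTensor, phiForm_eq]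
  simp only [reInner_eq_inner, matAct_eq_matOp, real_inner_comm ω ξ]
  ring

theorem weakPhiElliptic_iff :
    WeakPhiElliptic φ Ω (diagTensor a) ↔ DiagPhiElliptic φ Ω (diagOp a) := by
  simp only [WeakPhiElliptic, DiagPhiElliptic, weakForm_diagTensor]
  refine exists_congr fun κ => and_congr_right fun _ =>
    eventually_congr (Eventually.of_forall fun x => ⟨fun hx h ω ξ t hω ht => ?_,
      fun hx q ξ ω t hω ht => ?_⟩)
  · simpa [Finset.sum_ite_eq, ite_pow] using hx (EuclideanSpace.single h 1) ξ ω t hω ht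
  · rw [EuclideanSpace.real_norm_sq_eq, Finset.mul_sum, Finset.sum_mul]
    refine Finset.sum_le_sum fun h _ => ?_
    rw [mul_comm κ, mul_assoc]
    exact mul_le_mul_of_nonneg_left (hx h ω ξ t hω ht) (sq_nonneg _)

theorem StrongPhiElliptic.diagPhiElliptic (hs : StrongPhiElliptic φ Ω (diagTensor a)) :
    DiagPhiElliptic φ Ω (diagOp a) := by
  obtain ⟨κ, hκ, hx⟩ := hs
  refine ⟨κ, hκ, hx.mono fun x hx h ω ξ t hω ht => ?_⟩
  have hsingle := hx (Pi.single h ξ) ω t hω ht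
  rw [Finset.sum_eq_single h (by intro k _ hk; simp [hk]) (by simp),
    Finset.sum_eq_single h (by intro k _ hk; simp [hk, reInner_eq_inner]) (by simp),
    Finset.sum_eq_single h
      (by intro k _ hk; simp [hk, reInner_eq_inner, diagTensor, hk.symm, matAct])
      (by simp)] at hsingle
  simpa only [Pi.single_eq_same, diagTensor, if_true, diagOp, phiForm_matOp] using hsingle

end Coefficients

section Densities

variable {n m : ℕ} {φ G : ℝ → ℝ} {Ω : Set (RSpace n)} {u v w : RSpace n → CSpace m}
  {A : Fin n → RSpace n → CSpace m →L[ℝ] CSpace m}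

theorem pd_radialMap_comp (hG : IsRadialWeight G) (h : Fin n) {x : RSpace n}
    (hu : DifferentiableAt ℝ u x) (hx : u x ≠ 0) :
    pd h (fun y => radialMap G (u y)) x = fderiv ℝ (radialMap G) (u x) (pd h u x) := by
  rw [pd, fderiv_fun_comp x (hG.differentiableAt_radialMap hx) hu]
  rfl

theorem hasFDerivAt_zero_of_sq_norm_eq_mul {E F : Type*} [NormedAddCommGroup E] [NormedSpace ℝ E]
    [NormedAddCommGroup F] [NormedSpace ℝ F] {f g k : E → F} {x : E}
    (hf : HasFDerivAt f (0 : E →L[ℝ] F) x) (hg : HasFDerivAt g (0 : E →L[ℝ] F) x)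
    (hfx : f x = 0) (hgx : g x = 0) (hk : ∀ y, ‖k y‖ ^ 2 = ‖f y‖ * ‖g y‖) :
    HasFDerivAt k (0 : E →L[ℝ] F) x := by
  have hkx : k x = 0 := by simpa [hfx] using hk x
  simp only [hasFDerivAt_iff_isLittleO, hfx, hgx, hkx, zero_apply, sub_zero] at hf hg ⊢
  have hsq : (fun y => ‖k y‖ ^ 2) =o[𝓝 x] fun y => ‖y - x‖ ^ 2 := by
    simpa only [hk, sq] using hf.norm_norm.mul hg.norm_norm
  exact (hsq.of_pow two_ne_zero).of_norm_norm

theorem sq_norm_sqrtPhiMul (hφ : IsRadialWeight φ) (x : RSpace n) :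
    ‖sqrtPhiMul φ u x‖ ^ 2 = ‖u x‖ * ‖phiMul φ u x‖ := by
  rcases eq_or_ne (u x) 0 with hx | hx
  · simp [sqrtPhiMul, hx]
  · have hpos := hφ.pos _ (norm_pos_iff.2 hx)
    rw [sqrtPhiMul, phiMul, norm_smul, norm_smul, Real.norm_of_nonneg (Real.sqrt_nonneg _),
      Real.norm_of_nonneg hpos.le, mul_pow, Real.sq_sqrt hpos.le]
    ring

-- `√φ(|u|) u` need not be `C¹`, but its norm is the geometric mean of `|u|` and `|φ(|u|) u|`.
theorem ae_sqrtPhiMul_eq_zero_imp_fderiv_eq_zero (hφ : IsRadialWeight φ) (hu : ContDiff ℝ 1 u)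
    (hw : ContDiff ℝ 1 (phiMul φ u)) :
    ∀ᵐ x, sqrtPhiMul φ u x = 0 → fderiv ℝ (sqrtPhiMul φ u) x = 0 := by
  filter_upwards [ae_fderiv_eq_zero_of_eq_zero volume hu, ae_fderiv_eq_zero_of_eq_zero volume hw]
    with x hux hwx hx
  have hx0 : u x = 0 := hφ.sqrt.radialMap_eq_zero_iff.1 hx
  have hw0 : phiMul φ u x = 0 := by simp [phiMul, hx0]
  exact (hasFDerivAt_zero_of_sq_norm_eq_mul
    (hux hx0 ▸ (hu.differentiable one_ne_zero x).hasFDerivAt)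
    (hwx hw0 ▸ (hw.differentiable one_ne_zero x).hasFDerivAt) hx0 hw0
    (sq_norm_sqrtPhiMul hφ)).fderiv

theorem ae_energyDensity_eq_phiDensity (hφ : IsRadialWeight φ) (hu : ContDiff ℝ 1 u)
    (hw : ContDiff ℝ 1 (phiMul φ u)) :
    ∀ᵐ x, energyDensity A u (phiMul φ u) x = phiDensity φ A (sqrtPhiMul φ u) x := by
  filter_upwards [ae_fderiv_eq_zero_of_eq_zero volume hu,
    ae_sqrtPhiMul_eq_zero_imp_fderiv_eq_zero hφ hu hw] with x hux hvx
  refine Finset.sum_congr rfl fun h _ => ?_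
  by_cases hx : u x = 0
  · have hv : sqrtPhiMul φ u x = 0 := by simp [sqrtPhiMul, hx]
    simp [pd, phiForm, hux hx, hvx hv, hv]
  · have hdiff := hu.differentiable one_ne_zero x
    have hwpd : pd h (phiMul φ u) x = fderiv ℝ (radialMap φ) (u x) (pd h u x) :=
      pd_radialMap_comp hφ h hdiff hx
    have hvpd : pd h (sqrtPhiMul φ u) x =
        fderiv ℝ (radialMap fun s => √(φ s)) (u x) (pd h u x) :=
      pd_radialMap_comp hφ.sqrt h hdiff hx
    rw [hwpd, hvpd, hφ.inner_fderiv_radialMap _ hx]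
    rfl

theorem integral_energyDensity_eq (hφ : IsRadialWeight φ) (hu : ContDiff ℝ 1 u)
    (hw : ContDiff ℝ 1 (phiMul φ u)) :
    ∫ x in Ω, energyDensity A u (phiMul φ u) x = ∫ x in Ω, phiDensity φ A (sqrtPhiMul φ u) x :=
  integral_congr_ae (ae_restrict_of_ae (ae_energyDensity_eq_phiDensity hφ hu hw))

theorem integral_phiIntegrand_diagTensor {a : Fin n → RSpace n → Matrix (Fin m) (Fin m) ℂ}
    (hv : ContDiff ℝ 1 v) : ∫ x in Ω, phiIntegrand φ (diagTensor a) v x =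
      ∫ x in Ω, phiDensity φ (diagOp a) v x :=
  integral_congr_ae (ae_restrict_of_ae
    ((ae_fderiv_eq_zero_of_eq_zero volume hv).mono fun _ => phiIntegrand_diagTensor))

/-- The vector `Λ(|v|) ⟨ω, ∂_h v⟩ ω`, `ω = v / |v|`, that is added to and subtracted from `∂_h v`
in `phiDensity`. -/
noncomputable def phiCorrection (φ : ℝ → ℝ) (h : Fin n) (v : RSpace n → CSpace m)
    (x : RSpace n) : CSpace m :=
  (Lam φ ‖v x‖ * inner ℝ (‖v x‖⁻¹ • v x) (pd h v x)) • ‖v x‖⁻¹ • v x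

theorem measurable_phiCorrection (hφ : IsRadialWeight φ) {h : Fin n} (hv : Continuous v)
    (hpd : Continuous (pd h v)) : Measurable (phiCorrection φ h v) := by
  classical
  have hLam : Measurable ((Ioi 0).indicator (Lam φ)) := by
    rw [← piecewise_eq_indicator]
    exact hφ.continuousOn_Lam.measurable_piecewise continuousOn_const measurableSet_Ioi
  have heq : phiCorrection φ h v = fun x => ((Ioi 0).indicator (Lam φ) ‖v x‖ *
      inner ℝ (‖v x‖⁻¹ • v x) (pd h v x)) • ‖v x‖⁻¹ • v x := by
    funext x
    by_cases hx : v x = 0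
    · simp [phiCorrection, hx]
    · rw [phiCorrection, indicator_of_mem (mem_Ioi.2 (norm_pos_iff.2 hx))]
  have hω : Measurable fun x => ‖v x‖⁻¹ • v x := hv.norm.measurable.inv.smul hv.measurable
  rw [heq]
  exact ((hLam.comp hv.norm.measurable).mul (hω.inner hpd.measurable)).smul hω

theorem norm_phiCorrection_le (hφ : IsRadialWeight φ) {h : Fin n} (x : RSpace n) :
    ‖phiCorrection φ h v x‖ ≤ ‖pd h v x‖ := by
  by_cases hx : v x = 0
  · simp [phiCorrection, hx]
  have hω : ‖‖v x‖⁻¹ • v x‖ = 1 := norm_smul_inv_norm (𝕜 := ℝ) hx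
  have hΛ : |Lam φ ‖v x‖| ≤ 1 :=
    (sq_le_one_iff_abs_le_one _).1 (hφ.Lam_sq_lt_one (norm_pos_iff.2 hx)).le
  calc ‖phiCorrection φ h v x‖ = |Lam φ ‖v x‖| * |inner ℝ (‖v x‖⁻¹ • v x) (pd h v x)| := by
        rw [phiCorrection, norm_smul, hω, mul_one, Real.norm_eq_abs, abs_mul]
    _ ≤ 1 * (‖‖v x‖⁻¹ • v x‖ * ‖pd h v x‖) := by
        gcongr
        exact abs_real_inner_le_norm _ _
    _ = ‖pd h v x‖ := by rw [hω, one_mul, one_mul]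

theorem pd_eq_zero_of_notMem_tsupport {x : RSpace n} (h : Fin n) (hx : x ∉ tsupport u) :
    pd h u x = 0 := by
  rw [pd, fderiv_of_notMem_tsupport ℝ hx, zero_apply]

namespace IsTest

theorem continuous_pd (hu : IsTest Ω u) (h : Fin n) : Continuous (pd h u) :=
  (hu.1.continuous_fderiv one_ne_zero).clm_apply continuous_const

theorem exists_norm_pd_le (hu : IsTest Ω u) : ∃ C, ∀ h x, ‖pd h u x‖ ≤ C := by
  have hbound (h : Fin n) : ∃ C, ∀ x, ‖pd h u x‖ ≤ C :=
    (hu.continuous_pd h).bounded_above_of_compact_support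
      (.intro hu.2.1 fun _ => pd_eq_zero_of_notMem_tsupport h)
  choose C hC using hbound
  exact ⟨∑ h, |C h|, fun h x => (hC h x).trans ((le_abs_self _).trans
    (Finset.single_le_sum (f := fun h => |C h|) (fun _ _ => abs_nonneg _) (Finset.mem_univ h)))⟩

theorem integrableOn_energyDensity (hA : ∀ h, LocallyIntegrableOn (A h) Ω) (hu : IsTest Ω u)
    (hw : IsTest Ω w) : IntegrableOn (energyDensity A u w) Ω := by
  obtain ⟨C, hC⟩ := hu.exists_norm_pd_le
  obtain ⟨D, hD⟩ := hw.exists_norm_pd_le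
  exact integrable_finsetSum _ fun h _ => integrable_inner_clm_apply (hA h) hu.2.1 hu.2.2
    (hu.continuous_pd h).aestronglyMeasurable (hw.continuous_pd h).aestronglyMeasurable (hC h)
    (hD h) fun _ => pd_eq_zero_of_notMem_tsupport h

theorem integrableOn_gradSq (hu : IsTest Ω u) : IntegrableOn (gradSq u) Ω := by
  have heq : gradSq u = energyDensity (fun _ _ => ContinuousLinearMap.id ℝ _) u u := by
    funext x
    simp only [gradSq, energyDensity, ContinuousLinearMap.id_apply, real_inner_self_eq_norm_sq]
  rw [heq]
  exact hu.integrableOn_energyDensity (fun _ => locallyIntegrableOn_const _) hu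

theorem integrableOn_phiDensity (hφ : IsRadialWeight φ) (hA : ∀ h, LocallyIntegrableOn (A h) Ω)
    (hv : IsTest Ω v) : IntegrableOn (phiDensity φ A v) Ω := by
  obtain ⟨C, hC⟩ := hv.exists_norm_pd_le
  refine integrable_finsetSum _ fun h _ => ?_
  have hmeas := measurable_phiCorrection hφ hv.1.continuous (hv.continuous_pd h)
  have hpd : Measurable (pd h v) := (hv.continuous_pd h).measurable
  have hbound (x : RSpace n) : ‖phiCorrection φ h v x‖ ≤ C :=
    (norm_phiCorrection_le hφ x).trans (hC h x)
  refine integrable_inner_clm_apply (hA h) hv.2.1 hv.2.2 (hpd.add hmeas).aestronglyMeasurable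
    (hpd.sub hmeas).aestronglyMeasurable (fun x => norm_add_le_of_le (hC h x) (hbound x))
    (fun x => norm_sub_le_of_le (hC h x) (hbound x)) fun x hx => ?_
  simp [pd_eq_zero_of_notMem_tsupport h hx]

end IsTest

theorem phiDensity_sub_mul_gradSq_le {κ : ℝ} (hκ : 0 ≤ κ) (x : RSpace n) :
    phiDensity φ A v x - κ * gradSq v x ≤ phiDensity φ (shiftOp A κ) v x := by
  rw [phiDensity, gradSq, Finset.mul_sum, ← Finset.sum_sub_distrib]
  exact Finset.sum_le_sum fun h _ => phiForm_sub_mul_sq_norm_le hκ _ _ _ _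

theorem locallyIntegrableOn_shiftOp (hA : ∀ h, LocallyIntegrableOn (A h) Ω) (κ : ℝ) (h : Fin n) :
    LocallyIntegrableOn (shiftOp A κ h) Ω :=
  (hA h).sub (locallyIntegrableOn_const _)

theorem mul_gradSq_le_phiDensity {κ : ℝ} {x : RSpace n}
    (hell : ∀ (h : Fin n) (ω ξ : CSpace m) (t : ℝ), ‖ω‖ = 1 → 0 < t →
      κ * ‖ξ‖ ^ 2 ≤ phiForm (A h x) (Lam φ t) ω ξ) (hx : v x = 0 → fderiv ℝ v x = 0) :
    κ * gradSq v x ≤ phiDensity φ A v x := by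
  rw [gradSq, Finset.mul_sum]
  refine Finset.sum_le_sum fun h _ => ?_
  by_cases h0 : v x = 0
  · simp [pd, hx h0, phiForm]
  · exact hell h _ _ _ (norm_smul_inv_norm (𝕜 := ℝ) h0) (norm_pos_iff.2 h0)

theorem gradSq_nonneg (x : RSpace n) : 0 ≤ gradSq v x :=
  Finset.sum_nonneg fun _ _ => sq_nonneg _

namespace DiagPhiElliptic

variable {a : Fin n → RSpace n → Matrix (Fin m) (Fin m) ℂ}

theorem integralPhiElliptic (hφ : IsRadialWeight φ)
    (ha : ∀ h i j, LocallyIntegrableOn (fun x => a h x i j) Ω)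
    (hell : DiagPhiElliptic φ Ω (diagOp a)) : IntegralPhiElliptic φ Ω (diagTensor a) := by
  obtain ⟨κ, hκ, hae⟩ := hell
  refine ⟨κ, hκ, fun v hv => ?_⟩
  rw [integral_phiIntegrand_diagTensor hv.1, ← integral_const_mul]
  refine integral_mono_ae (hv.integrableOn_gradSq.const_mul κ)
    (hv.integrableOn_phiDensity hφ fun h => locallyIntegrableOn_matOp (ha h)) ?_
  filter_upwards [hae, ae_restrict_of_ae (ae_fderiv_eq_zero_of_eq_zero volume hv.1)] with x hx h0
  exact mul_gradSq_le_phiDensity hx h0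

theorem strictPhiDissipative (hφ : IsRadialWeight φ)
    (ha : ∀ h i j, LocallyIntegrableOn (fun x => a h x i j) Ω)
    (hell : DiagPhiElliptic φ Ω (diagOp a)) : StrictPhiDissipative φ Ω (diagTensor a) := by
  obtain ⟨κ, hκ, hae⟩ := hell
  refine ⟨κ, hκ, fun u hu hw => ?_⟩
  rw [energy_diagTensor, ← integral_const_mul]
  refine integral_mono_of_nonneg
    (Eventually.of_forall fun x => mul_nonneg hκ.le (gradSq_nonneg x))
    (hu.integrableOn_energyDensity (fun h => locallyIntegrableOn_matOp (ha h)) hw) ?_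
  filter_upwards [hae, ae_restrict_of_ae (ae_energyDensity_eq_phiDensity hφ hu.1 hw.1),
    ae_restrict_of_ae (ae_sqrtPhiMul_eq_zero_imp_fderiv_eq_zero hφ hu.1 hw.1)] with x hx heq h0
  rw [heq]
  exact mul_gradSq_le_phiDensity hx h0

theorem phiDissipative_subLaplacian (hφ : IsRadialWeight φ)
    (hell : DiagPhiElliptic φ Ω (diagOp a)) :
    ∃ κ : ℝ, 0 < κ ∧ PhiDissipative φ Ω (subLaplacian (diagTensor a) κ) := by
  obtain ⟨κ, hκ, hae⟩ := hell
  refine ⟨κ, hκ, fun u hu hw => ?_⟩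
  rw [subLaplacian_diagTensor, energy_diagTensor, diagOp_sub_smul_one,
    integral_energyDensity_eq hφ hu.1 hw.1]
  refine integral_nonneg_of_ae ?_
  filter_upwards [hae,
    ae_restrict_of_ae (ae_sqrtPhiMul_eq_zero_imp_fderiv_eq_zero hφ hu.1 hw.1)] with x hx h0
  exact (sub_nonneg.2 (mul_gradSq_le_phiDensity hx h0)).trans (phiDensity_sub_mul_gradSq_le hκ.le x)

end DiagPhiElliptic

end Densities

section Waves

variable {E F : Type*} [NormedAddCommGroup E] [NormedSpace ℝ E] [NormedAddCommGroup F]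
  [NormedSpace ℝ F] {W : ℝ → F} {p ψ : E → ℝ} {ℓ : E →L[ℝ] ℝ}

/-- The vector `(∂_e p)² W(p)`. A perturbation `p ζ` of a function that is equal to a constant `U₀`
contributes `∑ ⟨𝒜^h ζ, (∂_h p)² W(p)⟩` to the energy density, where `W(τ)` is the derivative of
`U ↦ φ(|U|) U` at `U₀ + τ ζ` in the direction `ζ`. -/
noncomputable def sqSlope (W : ℝ → F) (p : E → ℝ) (e x : E) : F :=
  (fderiv ℝ p x e) ^ 2 • W (p x)

theorem sqSlope_eq_zero_of_notMem (e : E) {x : E} (hx : x ∉ tsupport p) : sqSlope W p e x = 0 := by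
  simp [sqSlope, fderiv_of_notMem_tsupport ℝ hx]

theorem continuous_sqSlope (hp : ContDiff ℝ 1 p) (hW : ∀ x, ContinuousAt W (p x)) (e : E) :
    Continuous (sqSlope W p e) :=
  (((hp.continuous_fderiv one_ne_zero).clm_apply continuous_const).pow 2).smul
    (continuous_iff_continuousAt.2 fun x => (hW x).comp hp.continuous.continuousAt)

/-- The wave `r⁻¹ ψ sin(r² ℓ + α)`. As `r → ∞` it is of size `r⁻¹`, and its slope is of size `r`. -/
noncomputable def wave (ψ : E → ℝ) (ℓ : E →L[ℝ] ℝ) (r α : ℝ) (x : E) : ℝ :=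
  r⁻¹ * (ψ x * Real.sin (r ^ 2 * ℓ x + α))

theorem contDiff_wave (hψ : ContDiff ℝ 1 ψ) (r α : ℝ) : ContDiff ℝ 1 (wave ψ ℓ r α) := by
  unfold wave
  fun_prop

theorem tsupport_wave_subset (ψ : E → ℝ) (ℓ : E →L[ℝ] ℝ) (r α : ℝ) :
    tsupport (wave ψ ℓ r α) ⊆ tsupport ψ :=
  closure_mono fun x hx hψ => hx (by simp [wave, hψ])

theorem abs_wave_le {C : ℝ} (hC : ∀ x, |ψ x| ≤ C) {r : ℝ} (hr : 0 ≤ r) (α : ℝ) (x : E) :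
    |wave ψ ℓ r α x| ≤ r⁻¹ * C := by
  rw [wave, abs_mul, abs_mul, abs_of_nonneg (inv_nonneg.2 hr)]
  gcongr
  exact (mul_le_of_le_one_right (abs_nonneg _) (Real.abs_sin_le_one _)).trans (hC x)

theorem eventually_forall_wave {C : ℝ} (hC : ∀ x, |ψ x| ≤ C) {P : ℝ → Prop}
    (hP : ∀ᶠ τ in 𝓝 0, P τ) : ∀ᶠ r in atTop, ∀ α x, P (wave ψ ℓ r α x) := by
  obtain ⟨δ, hδ, hball⟩ := Metric.eventually_nhds_iff.1 hP
  have hlim : Tendsto (fun r : ℝ => r⁻¹ * C) atTop (𝓝 0) := by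
    simpa using tendsto_inv_atTop_zero.mul_const C
  filter_upwards [hlim.eventually_lt_const hδ, eventually_ge_atTop 0] with r hrδ hr α x
  refine hball ?_
  rw [Real.dist_0_eq_abs]
  exact (abs_wave_le hC hr α x).trans_lt hrδ

theorem fderiv_wave (hψ : ContDiff ℝ 1 ψ) {r : ℝ} (hr : r ≠ 0) (α : ℝ) (x e : E) :
    fderiv ℝ (wave ψ ℓ r α) x e = r * (ψ x * ℓ e * Real.cos (r ^ 2 * ℓ x + α) +
      (r ^ 2)⁻¹ * (fderiv ℝ ψ x e * Real.sin (r ^ 2 * ℓ x + α))) := by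
  have hsin := ((ℓ.hasFDerivAt (x := x)).const_mul (r ^ 2)).add_const α |>.sin
  have hwave : HasFDerivAt (wave ψ ℓ r α) _ x :=
    ((hψ.differentiable one_ne_zero x).hasFDerivAt.mul hsin).const_mul r⁻¹
  rw [hwave.fderiv]
  simp only [smul_apply, add_apply, smul_eq_mul]
  field_simp

theorem sq_inv_mul_fderiv_wave_add (hψ : ContDiff ℝ 1 ψ) {r : ℝ} (hr : r ≠ 0) (x e : E) :
    (r⁻¹ * fderiv ℝ (wave ψ ℓ r 0) x e) ^ 2 +
        (r⁻¹ * fderiv ℝ (wave ψ ℓ r (Real.pi / 2)) x e) ^ 2 =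
      (ψ x * ℓ e) ^ 2 + ((r ^ 2)⁻¹ * fderiv ℝ ψ x e) ^ 2 := by
  rw [fderiv_wave hψ hr, fderiv_wave hψ hr, inv_mul_cancel_left₀ hr, inv_mul_cancel_left₀ hr,
    add_zero, Real.cos_add_pi_div_two, Real.sin_add_pi_div_two]
  linear_combination ((ψ x * ℓ e) ^ 2 + ((r ^ 2)⁻¹ * fderiv ℝ ψ x e) ^ 2) *
    Real.sin_sq_add_cos_sq (r ^ 2 * ℓ x)

/-- The sum of `(∂_e p)² W(p) / r²` over two waves `p` in phase quadrature. Since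
`sin² + cos² = 1`, it does not oscillate in the limit `r → ∞`. -/
noncomputable def waveSqSlope (W : ℝ → F) (ψ : E → ℝ) (ℓ : E →L[ℝ] ℝ) (r : ℝ) (e x : E) : F :=
  (r ^ 2)⁻¹ • (sqSlope W (wave ψ ℓ r 0) e x + sqSlope W (wave ψ ℓ r (Real.pi / 2)) e x)

theorem waveSqSlope_eq (r : ℝ) (e x : E) : waveSqSlope W ψ ℓ r e x =
    (r⁻¹ * fderiv ℝ (wave ψ ℓ r 0) x e) ^ 2 • W (wave ψ ℓ r 0 x) +
      (r⁻¹ * fderiv ℝ (wave ψ ℓ r (Real.pi / 2)) x e) ^ 2 • W (wave ψ ℓ r (Real.pi / 2) x) := by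
  simp only [waveSqSlope, sqSlope, smul_add, smul_smul, mul_pow, inv_pow]

theorem sq_mul_add_sq_mul_le {C D s d r : ℝ} (hs : |s| ≤ C) (hd : |d| ≤ D) (hr : 1 ≤ r) :
    s ^ 2 + ((r ^ 2)⁻¹ * d) ^ 2 ≤ C ^ 2 + D ^ 2 := by
  have hinv : |(r ^ 2)⁻¹ * d| ≤ D := by
    rw [abs_mul, abs_of_nonneg (by positivity)]
    exact (mul_le_of_le_one_left (abs_nonneg _)
      (inv_le_one_of_one_le₀ (one_le_pow₀ hr))).trans hd
  rw [← sq_abs s, ← sq_abs (_ * d)]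
  gcongr

theorem norm_waveSqSlope_sub_le (hψ : ContDiff ℝ 1 ψ) {C D ε r : ℝ} {e x : E} {w : F}
    (hC : |ψ x * ℓ e| ≤ C) (hD : |fderiv ℝ ψ x e| ≤ D) (hr : 1 ≤ r)
    (hε : ∀ α, ‖W (wave ψ ℓ r α x) - w‖ ≤ ε) :
    ‖waveSqSlope W ψ ℓ r e x -
      ((ψ x * ℓ e) ^ 2 + ((r ^ 2)⁻¹ * fderiv ℝ ψ x e) ^ 2) • w‖ ≤ (C ^ 2 + D ^ 2) * ε := by
  have hε0 : 0 ≤ ε := (norm_nonneg _).trans (hε 0)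
  have hsum := sq_inv_mul_fderiv_wave_add (ℓ := ℓ) hψ (zero_lt_one.trans_le hr).ne' x e
  have hbound := hsum.trans_le (sq_mul_add_sq_mul_le hC hD hr)
  rw [waveSqSlope_eq, ← hsum, add_smul, add_sub_add_comm, ← smul_sub, ← smul_sub]
  refine (norm_add_le _ _).trans ?_
  rw [norm_smul, norm_smul, Real.norm_of_nonneg (sq_nonneg _), Real.norm_of_nonneg (sq_nonneg _)]
  refine (add_le_add (mul_le_mul_of_nonneg_left (hε _) (sq_nonneg _))
    (mul_le_mul_of_nonneg_left (hε _) (sq_nonneg _))).trans ?_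
  rw [← add_mul]
  gcongr

theorem tendsto_waveSqSlope (hψ : ContDiff ℝ 1 ψ) {C : ℝ} (hC : ∀ x, |ψ x| ≤ C)
    (hW : ContinuousAt W 0) (e x : E) :
    Tendsto (fun r => waveSqSlope W ψ ℓ r e x) atTop (𝓝 ((ψ x * ℓ e) ^ 2 • W 0)) := by
  have hsub : Tendsto (fun r => waveSqSlope W ψ ℓ r e x -
      ((ψ x * ℓ e) ^ 2 + ((r ^ 2)⁻¹ * fderiv ℝ ψ x e) ^ 2) • W 0) atTop (𝓝 0) := by
    set B := |ψ x * ℓ e| ^ 2 + |fderiv ℝ ψ x e| ^ 2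
    have hB : 0 < B + 1 := by positivity
    refine Metric.tendsto_nhds.2 fun ε hε => ?_
    have hnear : ∀ᶠ τ in 𝓝 0, ‖W τ - W 0‖ < ε / (B + 1) := by
      simpa only [dist_eq_norm] using Metric.tendsto_nhds.1 hW _ (div_pos hε hB)
    filter_upwards [eventually_ge_atTop 1, eventually_forall_wave (ℓ := ℓ) hC hnear] with r hr hτ
    rw [dist_zero_right]
    refine (norm_waveSqSlope_sub_le hψ le_rfl le_rfl hr fun α => (hτ α x).le).trans_lt ?_
    rw [mul_div_assoc', div_lt_iff₀ hB, mul_comm]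
    exact mul_lt_mul_of_pos_left (lt_add_one B) hε
  have hcoef : Tendsto (fun r : ℝ => (ψ x * ℓ e) ^ 2 + ((r ^ 2)⁻¹ * fderiv ℝ ψ x e) ^ 2) atTop
      (𝓝 ((ψ x * ℓ e) ^ 2)) := by
    have hinv : Tendsto (fun r : ℝ => (r ^ 2)⁻¹) atTop (𝓝 0) :=
      tendsto_inv_atTop_zero.comp (tendsto_pow_atTop two_ne_zero)
    simpa using ((hinv.mul_const (fderiv ℝ ψ x e)).pow 2).const_add ((ψ x * ℓ e) ^ 2)
  simpa using hsub.add (hcoef.smul_const (W 0))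

theorem eventually_norm_waveSqSlope_le (hψ : ContDiff ℝ 1 ψ) (hψc : HasCompactSupport ψ)
    (hW : ContinuousAt W 0) (e : E) : ∃ C, ∀ᶠ r in atTop, ∀ x, ‖waveSqSlope W ψ ℓ r e x‖ ≤ C := by
  obtain ⟨C, hC⟩ := hψ.continuous.bounded_above_of_compact_support hψc
  obtain ⟨D, hD⟩ := ((hψ.continuous_fderiv one_ne_zero).clm_apply
    continuous_const).bounded_above_of_compact_support (hψc.fderiv_apply ℝ e)
  have hnear : ∀ᶠ τ in 𝓝 0, ‖W τ - 0‖ ≤ ‖W 0‖ + 1 := by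
    simpa only [sub_zero] using
      (hW.norm.tendsto.eventually_lt_const (lt_add_one _)).mono fun _ => le_of_lt
  refine ⟨((C * |ℓ e|) ^ 2 + D ^ 2) * (‖W 0‖ + 1), ?_⟩
  filter_upwards [eventually_ge_atTop 1, eventually_forall_wave (ℓ := ℓ) hC hnear] with r hr hτ x
  have hCx : |ψ x * ℓ e| ≤ C * |ℓ e| := by
    rw [abs_mul]
    gcongr
    exact hC x
  simpa using norm_waveSqSlope_sub_le hψ hCx (hD x) hr fun α => hτ α x

end Waves

section WaveIntegrals

variable {E F : Type*} [NormedAddCommGroup E] [NormedSpace ℝ E] [MeasurableSpace E]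
  [BorelSpace E] [SecondCountableTopology E] [NormedAddCommGroup F] [InnerProductSpace ℝ F]
  {μ : Measure E} {Ω : Set E} {f : E → F} {W : ℝ → F} {p ψ : E → ℝ} {ℓ : E →L[ℝ] ℝ}

theorem integrableOn_inner_sqSlope (hf : LocallyIntegrableOn f Ω μ) (hp : ContDiff ℝ 1 p)
    (hpc : HasCompactSupport p) (hpΩ : tsupport p ⊆ Ω) (hW : ∀ x, ContinuousAt W (p x)) (e : E) :
    IntegrableOn (fun x => inner ℝ (f x) (sqSlope W p e x)) Ω μ := by
  have hsupp : tsupport (sqSlope W p e) ⊆ tsupport p :=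
    closure_minimal (fun x hx => by_contra fun hxp => hx (sqSlope_eq_zero_of_notMem e hxp))
      (isClosed_tsupport p)
  exact integrable_inner_of_hasCompactSupport hf (continuous_sqSlope hp hW e)
    (hpc.of_isClosed_subset (isClosed_tsupport _) hsupp) (hsupp.trans hpΩ)

theorem tendsto_integral_inner_waveSqSlope (hf : LocallyIntegrableOn f Ω μ)
    (hψ : ContDiff ℝ 1 ψ) (hψc : HasCompactSupport ψ) (hψΩ : tsupport ψ ⊆ Ω)
    (hW : ∀ᶠ τ in 𝓝 0, ContinuousAt W τ) (e : E) :
    Tendsto (fun r => ∫ x in Ω, inner ℝ (f x) (waveSqSlope W ψ ℓ r e x) ∂μ) atTop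
      (𝓝 (∫ x in Ω, inner ℝ (f x) ((ψ x * ℓ e) ^ 2 • W 0) ∂μ)) := by
  obtain ⟨C, hC⟩ := hψ.continuous.bounded_above_of_compact_support hψc
  obtain ⟨D, hD⟩ := eventually_norm_waveSqSlope_le (ℓ := ℓ) hψ hψc hW.self_of_nhds e
  refine tendsto_integral_inner_of_locallyIntegrableOn hf hψc hψΩ ?_ hD
    (Eventually.of_forall fun r x hx => ?_) (tendsto_waveSqSlope hψ hC hW.self_of_nhds e)
  · filter_upwards [eventually_forall_wave (ℓ := ℓ) hC hW] with r hr
    exact (((continuous_sqSlope (contDiff_wave hψ r 0) (hr 0) e).add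
      (continuous_sqSlope (contDiff_wave hψ r _) (hr _) e)).const_smul _).aestronglyMeasurable
  · rw [waveSqSlope, sqSlope_eq_zero_of_notMem e fun h => hx (tsupport_wave_subset _ _ _ _ h),
      sqSlope_eq_zero_of_notMem e fun h => hx (tsupport_wave_subset _ _ _ _ h), add_zero, smul_zero]

end WaveIntegrals

section Necessity

/-- Test functions `u` for which not only `φ(|u|) u` but also `√φ(|u|) u` is a test function, so
that the latter is admissible in the integral `Φ`-ellipticity condition. -/
structure IsRegularTest {n m : ℕ} (φ : ℝ → ℝ) (Ω : Set (RSpace n)) (u : RSpace n → CSpace m) :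
    Prop where
  isTest : IsTest Ω u
  phiMul : IsTest Ω (phiMul φ u)
  sqrtPhiMul : IsTest Ω (sqrtPhiMul φ u)

/-- `L^Φ`-dissipativity of `∂_h (𝒜^h ∂_h)`, tested with `IsRegularTest` functions only. -/
def RegularDissipative {n m : ℕ} (φ : ℝ → ℝ) (Ω : Set (RSpace n))
    (A : Fin n → RSpace n → CSpace m →L[ℝ] CSpace m) : Prop :=
  ∀ u, IsRegularTest φ Ω u → 0 ≤ ∫ x in Ω, energyDensity A u (phiMul φ u) x

/-- The derivative of `U ↦ φ(|U|) U` at `U₀ + τ ζ` in the direction `ζ`. -/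
noncomputable def radialSlope {F : Type*} [NormedAddCommGroup F] [InnerProductSpace ℝ F]
    (φ : ℝ → ℝ) (U₀ ζ : F) (τ : ℝ) : F :=
  fderiv ℝ (radialMap φ) (U₀ + τ • ζ) ζ

variable {n m : ℕ} {φ G : ℝ → ℝ} {Ω K : Set (RSpace n)} {u v : RSpace n → CSpace m}
  {A : Fin n → RSpace n → CSpace m →L[ℝ] CSpace m} {U₀ ζ : CSpace m} {p ψ : RSpace n → ℝ}

theorem regularDissipative_shiftOp (hφ : IsRadialWeight φ)
    (hA : ∀ h, LocallyIntegrableOn (A h) Ω) {κ : ℝ} (hκ : 0 ≤ κ)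
    (hstrict : ∀ u, IsRegularTest φ Ω u → κ * (∫ x in Ω, gradSq (sqrtPhiMul φ u) x) ≤
      ∫ x in Ω, energyDensity A u (phiMul φ u) x) :
    RegularDissipative φ Ω (shiftOp A κ) := by
  intro u hu
  have hle := hstrict u hu
  have hgrad := hu.sqrtPhiMul.integrableOn_gradSq.const_mul κ
  have hdens := hu.sqrtPhiMul.integrableOn_phiDensity hφ hA
  rw [integral_energyDensity_eq hφ hu.isTest.1 hu.phiMul.1, ← integral_const_mul,
    ← sub_nonneg, ← integral_sub hdens hgrad] at hle
  rw [integral_energyDensity_eq hφ hu.isTest.1 hu.phiMul.1]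
  exact hle.trans (integral_mono (hdens.sub hgrad)
    (hu.sqrtPhiMul.integrableOn_phiDensity hφ (locallyIntegrableOn_shiftOp hA κ))
    fun x => phiDensity_sub_mul_gradSq_le hκ x)

theorem exists_contDiff_cutoff {E : Type*} [NormedAddCommGroup E] [NormedSpace ℝ E]
    [FiniteDimensional ℝ E] {K Ω : Set E} (hK : IsCompact K) (hΩ : IsOpen Ω) (hKΩ : K ⊆ Ω) :
    ∃ θ : E → ℝ, ContDiff ℝ 1 θ ∧ HasCompactSupport θ ∧ tsupport θ ⊆ Ω ∧
      ∀ᶠ x in 𝓝ˢ K, θ x = 1 := by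
  obtain ⟨L, hL, hKL, hLΩ⟩ := exists_compact_between hK hΩ hKΩ
  obtain ⟨θ, hθK, hθL, -⟩ := exists_contMDiffMap_one_nhds_of_subset_interior (n := 1)
    (modelWithCornersSelf ℝ E) hK.isClosed hKL
  have hsupp : tsupport θ ⊆ L :=
    closure_minimal (fun x hx => by_contra fun hxL => hx (hθL x hxL)) hL.isClosed
  exact ⟨θ, θ.contMDiff.contDiff, hL.of_isClosed_subset (isClosed_tsupport _) hsupp,
    hsupp.trans hLΩ, hθK⟩

theorem isTest_comp_smul {θ : RSpace n → ℝ} (hθ : ContDiff ℝ 1 θ) (hθc : HasCompactSupport θ)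
    (hθΩ : tsupport θ ⊆ Ω) {g : ℝ → ℝ} (hg : ContDiff ℝ 1 g) (hg0 : g 0 = 0) (ω : CSpace m) :
    IsTest Ω fun x => g (θ x) • ω := by
  have hsupp : tsupport (fun x => g (θ x) • ω) ⊆ tsupport θ :=
    closure_mono fun x hx hθx => hx (by simp [hθx, hg0])
  exact ⟨(hg.comp hθ).smul contDiff_const,
    hθc.of_isClosed_subset (isClosed_tsupport _) hsupp, hsupp.trans hθΩ⟩

theorem exists_isRegularTest_eventuallyEq (hφ : IsRadialWeight φ) (hK : IsCompact K)
    (hΩ : IsOpen Ω) (hKΩ : K ⊆ Ω) (hU₀ : U₀ ≠ 0) :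
    ∃ u, IsRegularTest φ Ω u ∧ ∀ x ∈ K, u =ᶠ[𝓝 x] fun _ => U₀ := by
  obtain ⟨θ, hθ, hθc, hθΩ, hθK⟩ := exists_contDiff_cutoff hK hΩ hKΩ
  obtain ⟨ρ, hρ0, hρ1, hρ, hρG⟩ := IsRadialWeight.exists_profile
    (G := ![fun _ => 1, φ, fun s => √(φ s)])
    (by simp [Fin.forall_fin_succ, IsRadialWeight.one, hφ, hφ.sqrt]) (norm_pos_iff.2 hU₀)
  set ω := ‖U₀‖⁻¹ • U₀
  have hω : ‖ω‖ = 1 := norm_smul_inv_norm (𝕜 := ℝ) hU₀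
  have hradial (G : ℝ → ℝ) (hG : ContDiff ℝ 1 fun τ => ρ τ * G (ρ τ)) :
      IsTest Ω fun x => radialMap G (ρ (θ x) • ω) := by
    have heq : (fun x => radialMap G (ρ (θ x) • ω)) = fun x => (ρ (θ x) * G (ρ (θ x))) • ω := by
      funext x
      rw [radialMap, norm_smul, hω, Real.norm_of_nonneg (hρ _), mul_one, smul_smul, mul_comm]
    rw [heq]
    exact isTest_comp_smul hθ hθc hθΩ hG (by simp [hρ0]) ω
  refine ⟨fun x => ρ (θ x) • ω, ⟨?_, hradial φ (hρG 1), hradial _ (hρG 2)⟩, fun x hx => ?_⟩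
  · simpa [radialMap] using hradial _ (hρG 0)
  · filter_upwards [hθK.filter_mono (nhds_le_nhdsSet hx)] with y hy
    rw [hy, hρ1, smul_inv_smul₀ (norm_ne_zero_iff.2 hU₀)]

theorem IsTest.radialMap_add (hG : IsRadialWeight G) (hu : ContDiff ℝ 1 u)
    (hGu : IsTest Ω fun x => radialMap G (u x)) (hv : ContDiff ℝ 1 v)
    (hne : ∀ x ∈ tsupport v, u x ≠ 0 ∧ u x + v x ≠ 0) :
    IsTest Ω fun x => radialMap G ((u + v) x) := by
  have hsupp : tsupport (fun x => radialMap G ((u + v) x)) ⊆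
      tsupport fun x => radialMap G (u x) := by
    refine closure_mono fun x hx hGx => ?_
    have hux : u x = 0 := hG.radialMap_eq_zero_iff.1 hGx
    have hvx : v x = 0 := image_eq_zero_of_notMem_tsupport fun hxv => (hne x hxv).1 hux
    exact hx (by simp [hux, hvx])
  refine ⟨contDiff_iff_contDiffAt.2 fun x => ?_,
    hGu.2.1.of_isClosed_subset (isClosed_tsupport _) hsupp, hsupp.trans hGu.2.2⟩
  by_cases hx : x ∈ tsupport v
  · have hradial : ContDiffAt ℝ 1 (radialMap G) ((u + v) x) :=
      hG.contDiffOn_radialMap.contDiffAt (isOpen_ne.mem_nhds (hne x hx).2)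
    exact hradial.comp x (hu.add hv).contDiffAt
  · refine hGu.1.contDiffAt.congr_of_eventuallyEq ?_
    filter_upwards [notMem_tsupport_iff_eventuallyEq.1 hx] with y hy
    simp [hy]

theorem IsRegularTest.add (hφ : IsRadialWeight φ) (hu : IsRegularTest φ Ω u)
    (hv : ContDiff ℝ 1 v) (hne : ∀ x ∈ tsupport v, u x ≠ 0 ∧ u x + v x ≠ 0) :
    IsRegularTest φ Ω (u + v) where
  isTest := by
    have hone (w : RSpace n → CSpace m) : (fun x => radialMap (fun _ => 1) (w x)) = w :=
      funext fun x => one_smul ℝ (w x)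
    have hadd := IsTest.radialMap_add .one hu.isTest.1 ((hone u).symm ▸ hu.isTest) hv hne
    rwa [hone] at hadd
  phiMul := IsTest.radialMap_add hφ hu.isTest.1 hu.phiMul hv hne
  sqrtPhiMul := IsTest.radialMap_add hφ.sqrt hu.isTest.1 hu.sqrtPhiMul hv hne

theorem energyDensity_phiMul_congr {x : RSpace n} (huv : u =ᶠ[𝓝 x] v) :
    energyDensity A u (phiMul φ u) x = energyDensity A v (phiMul φ v) x := by
  have hphi : phiMul φ u =ᶠ[𝓝 x] phiMul φ v := huv.fun_comp (radialMap φ)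
  simp only [energyDensity, pd, huv.fderiv_eq, hphi.fderiv_eq]

theorem energyDensity_const_add_smul (hφ : IsRadialWeight φ) {x : RSpace n}
    (hp : DifferentiableAt ℝ p x) (hne : U₀ + p x • ζ ≠ 0) :
    energyDensity A (fun y => U₀ + p y • ζ) (phiMul φ fun y => U₀ + p y • ζ) x =
      ∑ h, inner ℝ (A h x ζ) (sqSlope (radialSlope φ U₀ ζ) p (EuclideanSpace.single h 1) x) := by
  have hdiff : HasFDerivAt (fun y => U₀ + p y • ζ) ((fderiv ℝ p x).smulRight ζ) x :=
    (hp.hasFDerivAt.smul_const ζ).const_add U₀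
  refine Finset.sum_congr rfl fun h _ => ?_
  have hpd : pd h (fun y => U₀ + p y • ζ) x =
      fderiv ℝ p x (EuclideanSpace.single h 1) • ζ := by
    rw [pd, hdiff.fderiv, ContinuousLinearMap.smulRight_apply]
  have hpdφ : pd h (phiMul φ fun y => U₀ + p y • ζ) x =
      fderiv ℝ p x (EuclideanSpace.single h 1) • radialSlope φ U₀ ζ (p x) := by
    rw [radialSlope, ← map_smul, ← hpd]
    exact pd_radialMap_comp hφ h hdiff.differentiableAt hne
  rw [hpd, hpdφ, map_smul, sqSlope, real_inner_smul_left, real_inner_smul_right,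
    real_inner_smul_right, sq, mul_assoc]

theorem energyDensity_add_smul (hφ : IsRadialWeight φ) (hp : ContDiff ℝ 1 p)
    (hu : ∀ x ∈ tsupport p, u =ᶠ[𝓝 x] fun _ => U₀) (hne : ∀ x, U₀ + p x • ζ ≠ 0) (x : RSpace n) :
    energyDensity A (u + fun y => p y • ζ) (phiMul φ (u + fun y => p y • ζ)) x =
      energyDensity A u (phiMul φ u) x +
        ∑ h, inner ℝ (A h x ζ) (sqSlope (radialSlope φ U₀ ζ) p (EuclideanSpace.single h 1) x) := by
  by_cases hx : x ∈ tsupport p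
  · have hzero : energyDensity A u (phiMul φ u) x = 0 := by
      simp [energyDensity, pd, (hu x hx).fderiv_eq]
    rw [hzero, zero_add, energyDensity_phiMul_congr ((hu x hx).add .rfl)]
    exact energyDensity_const_add_smul hφ (hp.differentiable one_ne_zero x) (hne x)
  · have hsum : u + (fun y => p y • ζ) =ᶠ[𝓝 x] u := by
      filter_upwards [notMem_tsupport_iff_eventuallyEq.1 hx] with y hy
      simp [hy]
    simp only [energyDensity_phiMul_congr hsum, sqSlope_eq_zero_of_notMem _ hx, inner_zero_right,
      Finset.sum_const_zero, add_zero]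

theorem locallyIntegrableOn_clm_apply_const {X E F : Type*} [TopologicalSpace X]
    [MeasurableSpace X] [NormedAddCommGroup E] [NormedSpace ℝ E] [NormedAddCommGroup F]
    [NormedSpace ℝ F] {μ : Measure X} {S : Set X} {B : X → E →L[ℝ] F}
    (hB : LocallyIntegrableOn B S μ) (e : E) : LocallyIntegrableOn (fun x => B x e) S μ :=
  (ContinuousLinearMap.apply ℝ F e).locallyIntegrableOn_comp hB

theorem continuousAt_radialSlope (hφ : IsRadialWeight φ) {τ : ℝ} (hne : U₀ + τ • ζ ≠ 0) :
    ContinuousAt (radialSlope φ U₀ ζ) τ := by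
  have hcont := hφ.continuousOn_fderiv_radialMap_apply.continuousAt
    ((isOpen_ne.preimage continuous_fst).mem_nhds (x := (U₀ + τ • ζ, ζ)) hne)
  exact hcont.comp (f := fun τ : ℝ => (U₀ + τ • ζ, ζ)) (by fun_prop)

theorem RegularDissipative.nonneg_add_sum_integral (hφ : IsRadialWeight φ)
    (hA : ∀ h, LocallyIntegrableOn (A h) Ω) (hdiss : RegularDissipative φ Ω A)
    (hu : IsRegularTest φ Ω u) (hU₀ : U₀ ≠ 0) (hp : ContDiff ℝ 1 p) (hpc : HasCompactSupport p)
    (hpΩ : tsupport p ⊆ Ω) (hup : ∀ x ∈ tsupport p, u =ᶠ[𝓝 x] fun _ => U₀)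
    (hne : ∀ x, U₀ + p x • ζ ≠ 0) :
    0 ≤ (∫ x in Ω, energyDensity A u (phiMul φ u) x) + ∑ h, ∫ x in Ω, inner ℝ (A h x ζ)
      (sqSlope (radialSlope φ U₀ ζ) p (EuclideanSpace.single h 1) x) := by
  have hreg : IsRegularTest φ Ω (u + fun y => p y • ζ) := by
    refine hu.add hφ (hp.smul contDiff_const) fun x hx => ?_
    have hxp := closure_mono (Function.support_smul_subset_left p fun _ => ζ) hx
    rw [(hup x hxp).self_of_nhds]
    exact ⟨hU₀, hne x⟩
  have hint (h : Fin n) : IntegrableOn (fun x => inner ℝ (A h x ζ)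
      (sqSlope (radialSlope φ U₀ ζ) p (EuclideanSpace.single h 1) x)) Ω :=
    integrableOn_inner_sqSlope (locallyIntegrableOn_clm_apply_const (hA h) ζ) hp hpc hpΩ
      (fun x => continuousAt_radialSlope hφ (hne x)) _
  have hnonneg := hdiss _ hreg
  simp only [energyDensity_add_smul hφ hp hup hne] at hnonneg
  rwa [integral_add (hu.isTest.integrableOn_energyDensity hA hu.phiMul)
    (integrable_finsetSum _ fun h _ => hint h),
    integral_finsetSum _ fun h _ => hint h] at hnonneg

theorem RegularDissipative.nonneg_add_sum_integral_waveSqSlope (hφ : IsRadialWeight φ)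
    (hA : ∀ h, LocallyIntegrableOn (A h) Ω) (hdiss : RegularDissipative φ Ω A)
    (hu : IsRegularTest φ Ω u) (hU₀ : U₀ ≠ 0) (hψ : ContDiff ℝ 1 ψ) (hψc : HasCompactSupport ψ)
    (hψΩ : tsupport ψ ⊆ Ω) (hψu : ∀ x ∈ tsupport ψ, u =ᶠ[𝓝 x] fun _ => U₀)
    {ℓ : RSpace n →L[ℝ] ℝ} {r : ℝ} (hne : ∀ α x, U₀ + wave ψ ℓ r α x • ζ ≠ 0) :
    0 ≤ (r ^ 2)⁻¹ * (2 * ∫ x in Ω, energyDensity A u (phiMul φ u) x) +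
      ∑ h, ∫ x in Ω, inner ℝ (A h x ζ)
        (waveSqSlope (radialSlope φ U₀ ζ) ψ ℓ r (EuclideanSpace.single h 1) x) := by
  have hcont (α : ℝ) (x : RSpace n) : ContinuousAt (radialSlope φ U₀ ζ) (wave ψ ℓ r α x) :=
    continuousAt_radialSlope hφ (hne α x)
  have hsub (α : ℝ) : tsupport (wave ψ ℓ r α) ⊆ tsupport ψ := tsupport_wave_subset ψ ℓ r α
  have hcompact (α : ℝ) : HasCompactSupport (wave ψ ℓ r α) :=
    hψc.of_isClosed_subset (isClosed_tsupport _) (hsub α)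
  have hwave (α : ℝ) := hdiss.nonneg_add_sum_integral hφ hA hu hU₀ (contDiff_wave hψ r α)
    (hcompact α) ((hsub α).trans hψΩ) (fun x hx => hψu x (hsub α hx)) (hne α)
  have hint (h : Fin n) (α : ℝ) : IntegrableOn (fun x => inner ℝ (A h x ζ)
      (sqSlope (radialSlope φ U₀ ζ) (wave ψ ℓ r α) (EuclideanSpace.single h 1) x)) Ω :=
    integrableOn_inner_sqSlope (locallyIntegrableOn_clm_apply_const (hA h) ζ)
      (contDiff_wave hψ r α) (hcompact α) ((hsub α).trans hψΩ) (hcont α) _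
  have hsum := mul_nonneg (inv_nonneg.2 (sq_nonneg r)) (add_nonneg (hwave 0) (hwave (Real.pi / 2)))
  simp only [waveSqSlope, real_inner_smul_right, inner_add_right, integral_const_mul,
    integral_add (hint _ _) (hint _ _), ← Finset.mul_sum, Finset.sum_add_distrib]
  linarith

theorem RegularDissipative.integral_sq_mul_inner_nonneg (hφ : IsRadialWeight φ)
    (hΩ : IsOpen Ω) (hA : ∀ h, LocallyIntegrableOn (A h) Ω) (hdiss : RegularDissipative φ Ω A)
    (hU₀ : U₀ ≠ 0) (ζ : CSpace m) (h : Fin n) (hψ : ContDiff ℝ 1 ψ) (hψc : HasCompactSupport ψ)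
    (hψΩ : tsupport ψ ⊆ Ω) :
    0 ≤ ∫ x in Ω, ψ x ^ 2 * inner ℝ (A h x ζ) (fderiv ℝ (radialMap φ) U₀ ζ) := by
  obtain ⟨u, hu, hψu⟩ := exists_isRegularTest_eventuallyEq hφ hψc hΩ hψΩ hU₀
  obtain ⟨C, hC⟩ := hψ.continuous.bounded_above_of_compact_support hψc
  set ℓ : RSpace n →L[ℝ] ℝ := EuclideanSpace.proj h
  have hne : ∀ᶠ τ : ℝ in 𝓝 0, U₀ + τ • ζ ≠ 0 := by
    have hcont : ContinuousAt (fun τ : ℝ => U₀ + τ • ζ) 0 := by fun_prop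
    exact hcont.eventually_ne (by simpa using hU₀)
  have hlim : Tendsto (fun r : ℝ => (r ^ 2)⁻¹ * (2 * ∫ x in Ω, energyDensity A u (phiMul φ u) x) +
      ∑ k, ∫ x in Ω, inner ℝ (A k x ζ)
        (waveSqSlope (radialSlope φ U₀ ζ) ψ ℓ r (EuclideanSpace.single k 1) x)) atTop
      (𝓝 (0 * (2 * ∫ x in Ω, energyDensity A u (phiMul φ u) x) +
        ∑ k, ∫ x in Ω, inner ℝ (A k x ζ)
          ((ψ x * ℓ (EuclideanSpace.single k 1)) ^ 2 • radialSlope φ U₀ ζ 0))) :=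
    ((tendsto_inv_atTop_zero.comp (tendsto_pow_atTop two_ne_zero)).mul_const _).add
      (tendsto_finsetSum _ fun k _ => tendsto_integral_inner_waveSqSlope
        (locallyIntegrableOn_clm_apply_const (hA k) ζ) hψ hψc hψΩ
        (hne.mono fun τ hτ => continuousAt_radialSlope hφ hτ) _)
  have hnonneg := ge_of_tendsto hlim <| (eventually_forall_wave (ℓ := ℓ) hC hne).mono fun r hr =>
    hdiss.nonneg_add_sum_integral_waveSqSlope hφ hA hu hU₀ hψ hψc hψΩ hψu hr
  rw [zero_mul, zero_add, Finset.sum_eq_single h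
    (fun k _ hk => by simp [ℓ, hk.symm]) (by simp)] at hnonneg
  simpa [ℓ, radialSlope, real_inner_smul_right] using hnonneg

theorem RegularDissipative.ae_inner_fderiv_radialMap_nonneg (hφ : IsRadialWeight φ)
    (hΩ : IsOpen Ω) (hA : ∀ h, LocallyIntegrableOn (A h) Ω) (hdiss : RegularDissipative φ Ω A) :
    ∀ᵐ x ∂(volume.restrict Ω), ∀ (h : Fin n) (U ζ : CSpace m), U ≠ 0 →
      0 ≤ inner ℝ (A h x ζ) (fderiv ℝ (radialMap φ) U ζ) := by
  refine ae_all_iff.2 fun h => ?_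
  have hpair : ∀ᵐ x ∂(volume.restrict Ω), ∀ y ∈ {y : CSpace m × CSpace m | y.1 ≠ 0},
      0 ≤ inner ℝ (A h x y.2) (fderiv ℝ (radialMap φ) y.1 y.2) := by
    refine ae_forall_mem_nonneg (fun x =>
      ((A h x).continuous.comp continuous_snd).continuousOn.inner
        hφ.continuousOn_fderiv_radialMap_apply) fun y hy => ?_
    have hloc : LocallyIntegrableOn
        (fun x => inner ℝ (A h x y.2) (fderiv ℝ (radialMap φ) y.1 y.2)) Ω := by
      simpa only [Function.comp_def, innerSL_apply_apply, real_inner_comm] using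
        (innerSL ℝ (fderiv ℝ (radialMap φ) y.1 y.2)).locallyIntegrableOn_comp
          (locallyIntegrableOn_clm_apply_const (hA h) y.2)
    exact ae_nonneg_of_integral_sq_mul_nonneg hΩ hloc fun ψ hψ hψc hψΩ =>
      hdiss.integral_sq_mul_inner_nonneg hφ hΩ hA hy y.2 h hψ hψc hψΩ
  exact hpair.mono fun x hx U ζ hU => hx (U, ζ) hU

theorem RegularDissipative.diagPhiElliptic (hφ : IsRadialWeight φ) (hΛ : LamInfSq φ < 1)
    (hΩ : IsOpen Ω) (hA : ∀ h, LocallyIntegrableOn (A h) Ω) {κ : ℝ} (hκ : 0 < κ)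
    (hdiss : RegularDissipative φ Ω (shiftOp A κ)) : DiagPhiElliptic φ Ω A := by
  refine ⟨κ * (1 - LamInfSq φ), mul_pos hκ (sub_pos.2 hΛ), ?_⟩
  filter_upwards [hdiss.ae_inner_fderiv_radialMap_nonneg hφ hΩ (locallyIntegrableOn_shiftOp hA κ)]
    with x hx h ω ξ t hω ht
  exact mul_sq_norm_le_phiForm hκ.le (hφ.Lam_sq_le_LamInfSq ht) hω
    (hφ.phiForm_nonneg (hx h) ht hω ξ)

end Necessity

theorem mainTheorem3_general {n m : ℕ} {φ : ℝ → ℝ} (hφ : IsRadialWeight φ)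
    (hΛ : LamInfSq φ < 1) {Ω : Set (RSpace n)} (hΩ : IsOpen Ω)
    {a : Fin n → RSpace n → Matrix (Fin m) (Fin m) ℂ}
    (ha : ∀ h i j, LocallyIntegrableOn (fun x => a h x i j) Ω volume) :
    List.TFAE
      [StrictPhiDissipative φ Ω (diagTensor a),
       ∃ κ : ℝ, 0 < κ ∧ PhiDissipative φ Ω (subLaplacian (diagTensor a) κ),
       IntegralPhiElliptic φ Ω (diagTensor a),
       WeakPhiElliptic φ Ω (diagTensor a)] ∧
    (StrongPhiElliptic φ Ω (diagTensor a) →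
      StrictPhiDissipative φ Ω (diagTensor a) ∧
      (∃ κ : ℝ, 0 < κ ∧ PhiDissipative φ Ω (subLaplacian (diagTensor a) κ)) ∧
      IntegralPhiElliptic φ Ω (diagTensor a) ∧
      WeakPhiElliptic φ Ω (diagTensor a)) := by
  have hA (h : Fin n) : LocallyIntegrableOn (diagOp a h) Ω := locallyIntegrableOn_matOp (ha h)
  rw [weakPhiElliptic_iff]
  refine ⟨?_, fun hs => ?_⟩
  · tfae_have 1 → 4 := fun ⟨κ, hκ, hstrict⟩ =>
      (regularDissipative_shiftOp hφ hA hκ.le fun u hu => by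
        simpa only [energy_diagTensor] using hstrict u hu.isTest hu.phiMul).diagPhiElliptic
        hφ hΛ hΩ hA hκ
    tfae_have 2 → 4 := fun ⟨κ, hκ, hdiss⟩ =>
      RegularDissipative.diagPhiElliptic hφ hΛ hΩ hA hκ fun u hu => by
        simpa only [subLaplacian_diagTensor, energy_diagTensor, diagOp_sub_smul_one] using
          hdiss u hu.isTest hu.phiMul
    tfae_have 3 → 4 := fun ⟨κ, hκ, hell⟩ =>
      (regularDissipative_shiftOp hφ hA hκ.le fun u hu => by
        simpa only [integral_energyDensity_eq hφ hu.isTest.1 hu.phiMul.1,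
          integral_phiIntegrand_diagTensor hu.sqrtPhiMul.1] using
          hell _ hu.sqrtPhiMul).diagPhiElliptic hφ hΛ hΩ hA hκ
    tfae_have 4 → 1 := DiagPhiElliptic.strictPhiDissipative hφ ha
    tfae_have 4 → 2 := DiagPhiElliptic.phiDissipative_subLaplacian hφ
    tfae_have 4 → 3 := DiagPhiElliptic.integralPhiElliptic hφ ha
    tfae_finish
  · have hell := hs.diagPhiElliptic
    exact ⟨hell.strictPhiDissipative hφ ha, hell.phiDissipative_subLaplacian hφ,
      hell.integralPhiElliptic hφ ha, hell⟩

theorem mainTheorem3 {n m : ℕ} (hn : 2 ≤ n) (φ : ℝ → ℝ) (hφ : AdmissiblePhi φ)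
    (hΛ : LamInfSq φ < 1)
    (Ω : Set (RSpace n)) (hΩ_open : IsOpen Ω) (hΩ_conn : IsConnected Ω)
    (a : Fin n → RSpace n → Matrix (Fin m) (Fin m) ℂ)
    (ha : ∀ h i j, LocallyIntegrableOn (fun x => a h x i j) Ω volume) :
    List.TFAE
      [StrictPhiDissipative φ Ω (diagTensor a),
       ∃ κ : ℝ, 0 < κ ∧ PhiDissipative φ Ω (subLaplacian (diagTensor a) κ),
       IntegralPhiElliptic φ Ω (diagTensor a),
       WeakPhiElliptic φ Ω (diagTensor a)] ∧
    (StrongPhiElliptic φ Ω (diagTensor a) →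
      StrictPhiDissipative φ Ω (diagTensor a) ∧
      (∃ κ : ℝ, 0 < κ ∧ PhiDissipative φ Ω (subLaplacian (diagTensor a) κ)) ∧
      IntegralPhiElliptic φ Ω (diagTensor a) ∧
      WeakPhiElliptic φ Ω (diagTensor a)) :=
  mainTheorem3_general hφ.isRadialWeight hΛ hΩ_open ha
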